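/- Let $f\in C^2(\mathbb R)$, $a,c\in\mathbb R$, and let $u$ be a non-constant real solution of $u_{xx}+f(u)-cu=a$ on $\mathbb R$ that is periodic with period $T>0$; thus $u$ is a periodic standing wave of $u_t=u_{xxx}+(f(u))_x-cu_x$. Put $\mathcal L[u]=-\partial_x^2-f'(u)+c$. Say that $\mu\in\mathbb C$ is in the spectrum of $\partial_x\mathcal L[u]$ if $\partial_x\mathcal L[u]\psi=\mu\psi$ has a bounded solution $\psi:\mathbb R\to\mathbb C$ of class $C^3$ with $\psi\not\equiv 0$. For $\mu\in\mathbb C$ let $\Phi(x,\mu)$ be the solution of $$\Phi_x=\begin{pmatrix}0&1&0\\0&0&1\\-\mu-u_xf''(u)&-f'(u)+c&0\end{pmatrix}\Phi,\qquad \Phi(0,\mu)=\mathbf I,$$ and let $\mathbf M(\mu)=\Phi(T,\mu)$ be the monodromy matrix. The multiplicity of $\mu$ is the number of zeros $\lambda$ of $\det(\mathbf M(\mu)-\lambda\mathbf I)$ with $|\lambda|=1$, counted with multiplicity. Suppose that $\operatorname{tr}\mathbf M_{\mu\mu\mu}(0)\neq 0$, and set $$\Delta=\tfrac12\bigl(\operatorname{tr}\mathbf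 M_{\mu\mu}(0)\bigr)^3-3\bigl(\operatorname{tr}\mathbf M_{\mu\mu\mu}(0)\bigr)^2$$ (these traces are real). 1. If $\Delta>0$, then there is $r>0$ such that the part of the spectrum in the disc $|\mu|<r$ is exactly the part of the imaginary axis in this disc, and each of its points has multiplicity three. 2. If $\Delta<0$, then there are $r>0$, $\varepsilon>0$, a non-real root $y$ of the real cubic $1-\frac{y^2}{2}\operatorname{tr}\mathbf M_{\mu\mu}(0)+\frac{y^3}{3}\operatorname{tr}\mathbf M_{\mu\mu\mu}(0)$, and two injective $C^\infty$ curves $\gamma_2,\gamma_3:(-\varepsilon,\varepsilon)\to\mathbb C$ with $\gamma_2(0)=\gamma_3(0)=0$, $\gamma_2'(0)=iy$ and $\gamma_3'(0)=i\bar y$ (so they are tangent at the origin to lines off the imaginary axis), which meet each other and the imaginary axis only at the origin, at parameter value $0$, such that the part of the spectrum in the disc $|\mu|<r$ is exactly the part in this disc of the union of the imaginary axis and the two curves. Each point $\mu\neq 0$ of the imaginary axis with $|\mu|<r$ has multiplicity one. In particular the wave is modulationally unstable: every neighbourhood of the origin contains points of the spectrum with positive real part. -/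

import Mathlib

open Complex ComplexConjugate Metric Set
open scoped ContDiff

noncomputable section

namespace GKdV

/-- Global solvability of a linear initial value problem with continuous coefficient. -/
theorem exists_linearODE_solution {𝔸 : Type*} [NormedRing 𝔸] [NormedAlgebra ℝ 𝔸]
    [CompleteSpace 𝔸] (A : ℝ → 𝔸) (hA : Continuous A) :
    ∃ Φ : ℝ → 𝔸, Φ 0 = 1 ∧ ∀ x, HasDerivAt Φ (A x * Φ x) x := by
  let P : ℕ → ℝ → 𝔸 := fun n => Nat.rec (fun _ => 1) (fun _ p x => ∫ t in (0 : ℝ)..x, A t * p t) n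
  have hP0 : P 0 = fun _ => 1 := rfl
  have hPs : ∀ n, P (n + 1) = fun x => ∫ t in (0 : ℝ)..x, A t * P n t := fun n => rfl
  have hcont : ∀ n, Continuous (P n) := by
    intro n
    induction n with
    | zero => rw [hP0]; exact continuous_const
    | succ n ih =>
      rw [hPs]
      exact intervalIntegral.continuous_primitive
        (fun a b => (hA.mul ih).intervalIntegrable a b) 0
  have hder : ∀ n x, HasDerivAt (P (n + 1)) (A x * P n x) x := by
    intro n x
    rw [hPs]
    exact ((hA.mul (hcont n)).integral_hasStrictDerivAt 0 x).hasDerivAt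
  have hbound : ∀ R K : ℝ, (∀ x, |x| ≤ R → ‖A x‖ ≤ K) →
      ∀ n x, |x| ≤ R → ‖P n x‖ ≤ ‖(1 : 𝔸)‖ * (K ^ n * |x| ^ n / n.factorial) := by
    intro R K hK n
    induction n with
    | zero => intro x hx; simp [hP0]
    | succ n ih =>
      intro x hx
      have hK0 : 0 ≤ K := (norm_nonneg _).trans (hK 0 (by simpa using (abs_nonneg x).trans hx))
      have hint : ∀ y : ℝ, 0 ≤ y → ∫ t in (0 : ℝ)..y, |t| ^ n = y ^ (n + 1) / (n + 1) := by
        intro y hy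
        have : ∫ t in (0 : ℝ)..y, |t| ^ n = ∫ t in (0 : ℝ)..y, t ^ n := by
          apply intervalIntegral.integral_congr
          intro t ht
          rw [Set.uIcc_of_le hy] at ht
          simp [abs_of_nonneg ht.1]
        rw [this, integral_pow]; simp
      have habs : |∫ t in (0 : ℝ)..x, |t| ^ n| = |x| ^ (n + 1) / (n + 1) := by
        rcases le_total 0 x with h | h
        · rw [hint x h, abs_of_nonneg h, abs_of_nonneg (by positivity)]
        · have h1 := intervalIntegral.integral_comp_neg (a := (0 : ℝ)) (b := -x)
            (f := fun t : ℝ => |t| ^ n)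
          simp only [abs_neg, neg_neg, neg_zero] at h1
          rw [hint (-x) (by linarith)] at h1
          rw [intervalIntegral.integral_symm, ← h1, abs_neg, abs_of_nonpos h,
            abs_of_nonneg (div_nonneg (pow_nonneg (by linarith) _) (by positivity))]
      have h2 : ‖P (n + 1) x‖ ≤
          |∫ t in (0 : ℝ)..x, (‖(1 : 𝔸)‖ * K ^ (n + 1) / n.factorial) * |t| ^ n| := by
        rw [hPs]
        apply intervalIntegral.norm_integral_le_abs_of_norm_le
        · refine MeasureTheory.ae_restrict_of_forall_mem measurableSet_uIoc fun t ht => ?_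
          · have htx : |t| ≤ R := by
              refine le_trans ?_ hx
              have := Set.uIoc_subset_uIcc ht
              have h3 := Set.abs_sub_left_of_mem_uIcc this
              simpa using h3
            calc ‖A t * P n t‖ ≤ ‖A t‖ * ‖P n t‖ := norm_mul_le _ _
              _ ≤ K * (‖(1 : 𝔸)‖ * (K ^ n * |t| ^ n / n.factorial)) :=
                mul_le_mul (hK t htx) (ih t htx) (norm_nonneg _) hK0
              _ = _ := by ring
        · apply Continuous.intervalIntegrable
          fun_prop
      refine h2.trans (le_of_eq ?_)
      rw [intervalIntegral.integral_const_mul, abs_mul, habs, abs_of_nonneg (by positivity),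
        Nat.factorial_succ]
      push_cast
      field_simp
  refine ⟨fun x => ∑' n, P n x, ?_, ?_⟩
  · show ∑' n, P n 0 = 1
    rw [tsum_eq_single 0]
    · simp [hP0]
    · intro n hn
      obtain ⟨m, rfl⟩ := Nat.exists_eq_succ_of_ne_zero hn
      simp [hPs]
  · intro x
    set R := |x| + 1 with hR
    obtain ⟨K, hK⟩ : ∃ K, ∀ y ∈ Set.Icc (-R) R, ‖A y‖ ≤ K :=
      isCompact_Icc.exists_bound_of_continuousOn hA.continuousOn
    have hK' : ∀ y, |y| ≤ R → ‖A y‖ ≤ K := fun y hy => hK y (abs_le.mp hy)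
    have hK0 : 0 ≤ K := (norm_nonneg _).trans (hK' 0 (by rw [abs_zero]; positivity))
    have hR0 : 0 ≤ R := by positivity
    have hsum : Summable fun n : ℕ => ‖(1 : 𝔸)‖ * ((K * R) ^ n / n.factorial) :=
      (Real.summable_pow_div_factorial (K * R)).mul_left _
    have hle : ∀ n y, |y| ≤ R → ‖P n y‖ ≤ ‖(1 : 𝔸)‖ * ((K * R) ^ n / n.factorial) := by
      intro n y hy
      refine (hbound R K hK' n y hy).trans ?_
      rw [mul_pow]
      gcongr
    have hsumP : ∀ y, |y| ≤ R → Summable fun n => P n y := fun y hy =>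
      Summable.of_norm_bounded hsum fun n => hle n y hy
    have hxR : |x| ≤ R := by simp [hR]
    have key := hasDerivAt_tsum_of_isPreconnected (𝕜 := ℝ) (t := Set.Ioo (-R) R)
      (g := fun n y => P (n + 1) y) (g' := fun n y => A y * P n y)
      (hsum.mul_left K) isOpen_Ioo isPreconnected_Ioo
      (fun n y _ => hder n y)
      (fun n y hy => (norm_mul_le _ _).trans (mul_le_mul (hK' y (abs_le.mpr ⟨hy.1.le, hy.2.le⟩))
        (hle n y (abs_le.mpr ⟨hy.1.le, hy.2.le⟩)) (norm_nonneg _) hK0))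
      (y₀ := x) (abs_lt.mp (by simp [hR]))
      ((summable_nat_add_iff 1).mpr (hsumP x hxR)) (y := x) (abs_lt.mp (by simp [hR]))
    rw [(hsumP x hxR).tsum_mul_left] at key
    have hev : (fun y => ∑' n, P n y) =ᶠ[nhds x] fun y => 1 + ∑' n, P (n + 1) y := by
      filter_upwards [isOpen_Ioo.mem_nhds (show x ∈ Set.Ioo (-R) R from
        abs_lt.mp (by simp [hR]))] with y hy
      rw [(hsumP y (abs_le.mpr ⟨hy.1.le, hy.2.le⟩)).tsum_eq_zero_add, hP0]
    exact (key.const_add 1).congr_of_eventuallyEq hev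

/-- A linear system with continuous coefficient matrix has a global fundamental matrix. -/
theorem exists_matrixODE_solution (A : ℝ → Matrix (Fin 3) (Fin 3) ℂ) (hA : Continuous A) :
    ∃ Φ : ℝ → Matrix (Fin 3) (Fin 3) ℂ, Φ 0 = 1 ∧
      ∀ x i j, HasDerivAt (fun y => Φ y i j) ((A x * Φ x) i j) x := by
  let _ : NormedRing (Matrix (Fin 3) (Fin 3) ℂ) := Matrix.linftyOpNormedRing
  let _ : NormedAlgebra ℝ (Matrix (Fin 3) (Fin 3) ℂ) := Matrix.linftyOpNormedAlgebra
  obtain ⟨Φ, h0, h⟩ := exists_linearODE_solution A hA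
  refine ⟨Φ, h0, fun x i j => ?_⟩
  exact ((Matrix.entryLinearMap ℝ ℂ i j).toContinuousLinearMap.hasFDerivAt).comp_hasDerivAt x (h x)

open Classical in
/-- The fundamental matrix `Φ` of `Φ' = A Φ`, `Φ 0 = 1`, for a continuous coefficient matrix `A`
(the constant `1` if `A` is not continuous). -/
def fundamentalMatrix (A : ℝ → Matrix (Fin 3) (Fin 3) ℂ) : ℝ → Matrix (Fin 3) (Fin 3) ℂ :=
  if hA : Continuous A then Classical.choose (exists_matrixODE_solution A hA) else fun _ => 1

theorem fundamentalMatrix_spec (A : ℝ → Matrix (Fin 3) (Fin 3) ℂ) (hA : Continuous A) :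
    fundamentalMatrix A 0 = 1 ∧ ∀ x i j,
      HasDerivAt (fun y => fundamentalMatrix A y i j) ((A x * fundamentalMatrix A x) i j) x := by
  rw [fundamentalMatrix, dif_pos hA]
  exact Classical.choose_spec (exists_matrixODE_solution A hA)

/-- `u` is a standing wave of `u_t = u_xxx + (f(u))_x - c u_x`: it solves
`u_xx + f(u) - c u = a`, where `a` is a constant of integration. -/
def IsStandingWave (f : ℝ → ℝ) (a c : ℝ) (u : ℝ → ℝ) : Prop :=
  ContDiff ℝ 2 u ∧ ∀ x, deriv (deriv u) x + f (u x) - c * u x = a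

/-- The linearized operator `∂ₓ𝓛[u]`, where `𝓛[u] = -∂ₓ² - f'(u) + c`. -/
def linearizedOp (f : ℝ → ℝ) (c : ℝ) (u : ℝ → ℝ) (ψ : ℝ → ℂ) : ℝ → ℂ :=
  deriv fun x => -deriv (deriv ψ) x - ((deriv f (u x) : ℝ) : ℂ) * ψ x + (c : ℂ) * ψ x

/-- `μ` is in the spectrum of `∂ₓ𝓛[u]` if `∂ₓ𝓛[u] ψ = μ ψ` has a bounded solution `ψ ≠ 0`. -/
def spec (f : ℝ → ℝ) (c : ℝ) (u : ℝ → ℝ) : Set ℂ :=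
  {μ | ∃ ψ : ℝ → ℂ, ContDiff ℝ 3 ψ ∧ ψ ≠ 0 ∧ (∃ C : ℝ, ∀ x, ‖ψ x‖ ≤ C) ∧
    ∀ x, linearizedOp f c u ψ x = μ * ψ x}

/-- The coefficient matrix `H(x; μ)` of `∂ₓ𝓛[u] ψ = μ ψ`, written as a first-order system for
`(ψ, ψ', ψ'')`. -/
def coeffMatrix (f : ℝ → ℝ) (c : ℝ) (u : ℝ → ℝ) (μ : ℂ) (x : ℝ) : Matrix (Fin 3) (Fin 3) ℂ :=
  !![0, 1, 0;
     0, 0, 1;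
     -μ - ((deriv u x * deriv (deriv f) (u x) : ℝ) : ℂ), ((-deriv f (u x) + c : ℝ) : ℂ), 0]

theorem continuous_coeffMatrix {f : ℝ → ℝ} (hf : ContDiff ℝ 2 f) {a c : ℝ} {u : ℝ → ℝ}
    (hu : IsStandingWave f a c u) (μ : ℂ) : Continuous (coeffMatrix f c u μ) := by
  have h1 : Continuous (deriv u) := hu.1.continuous_deriv (by norm_num)
  have h2 : Continuous (deriv f) := hf.continuous_deriv (by norm_num)
  have h3 : Continuous (deriv (deriv f)) := by
    have := hf.continuous_iteratedDeriv 2 le_rfl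
    rwa [iteratedDeriv_succ, iteratedDeriv_one] at this
  have h4 : Continuous u := hu.1.continuous
  refine continuous_matrix fun i j => ?_
  fin_cases i <;> fin_cases j <;> simp [coeffMatrix] <;> fun_prop

/-- The monodromy matrix `M(μ) = Φ(T, μ)`. -/
def monodromy (f : ℝ → ℝ) (c : ℝ) (u : ℝ → ℝ) (T : ℝ) (μ : ℂ) : Matrix (Fin 3) (Fin 3) ℂ :=
  fundamentalMatrix (coeffMatrix f c u μ) T

open Classical in
/-- The multiplicity of `μ` as a point of the spectrum: the number of zeros `z` of
`det (M(μ) - z)` on the unit circle, counted with multiplicity. -/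
def multiplicity (f : ℝ → ℝ) (c : ℝ) (u : ℝ → ℝ) (T : ℝ) (μ : ℂ) : ℕ :=
  (monodromy f c u T μ).charpoly.roots.countP fun z => ‖z‖ = 1

/-- The trace of the `k`-th derivative of `M` at `μ = 0`. It is a real number, because `M(μ)` is
real for real `μ`. -/
def trDeriv (f : ℝ → ℝ) (c : ℝ) (u : ℝ → ℝ) (T : ℝ) (k : ℕ) : ℝ :=
  (Matrix.trace (Matrix.of fun i j =>
    iteratedDeriv k (fun μ : ℂ => monodromy f c u T μ i j) 0)).re

/-- The discriminant `Δ = (tr M_μμ(0))³ / 2 - 3 (tr M_μμμ(0))²`. -/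
def discriminant (f : ℝ → ℝ) (c : ℝ) (u : ℝ → ℝ) (T : ℝ) : ℝ :=
  1 / 2 * trDeriv f c u T 2 ^ 3 - 3 * trDeriv f c u T 3 ^ 2

/-- Modulational instability: there is unstable spectrum arbitrarily close to the origin. -/
def ModulationallyUnstable (f : ℝ → ℝ) (c : ℝ) (u : ℝ → ℝ) : Prop :=
  ∀ r > 0, ∃ μ ∈ spec f c u, ‖μ‖ < r ∧ 0 < μ.re

end GKdV

end

/-! By Floquet theory, `μ` lies in the spectrum exactly when the monodromy matrix has an eigenvalue
of modulus one (`mem_spec_iff`). In the variables `(ψ, ψ', 𝓛ψ)` the system is trace-free and carries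
a bilinear form pairing `μ` with `-μ`. Hence, with `a(μ)` the trace, the characteristic polynomial
is `z³ - a(μ) z² + a(-μ) z - 1` (`eval_charpoly_reducedMonodromy`). Everything is encoded in the
entire function `a`, which commutes with conjugation.

The derivative `u'` is a periodic element of the kernel of `𝓛` with mean zero. This forces `a(0) =
3` and `a'(0) = 0` (`trace_reducedMonodromy_expansion`), so the three multipliers all tend to `1` as
`μ` tends to `0`. The singularity is resolved by putting `μ = iη` and `z = (1 + iησ)/(1 - iησ)`: a
factor `η³` splits off, and at `η = 0` there remains the real cubic `4σ³ - b₂σ - b₃`, where `b₂` and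
`b₃` are `tr M_μμ(0)/2` and `tr M_μμμ(0)/6` (`exists_scaledCubic`). Up to the factor 4 its
discriminant is `Δ`. When `Δ ≠ 0` its roots are simple, and each root `s` continues to an analytic
branch `φ(η)` (`exists_isBranch`).

A multiplier is unimodular exactly when `ηφ(η)` is real. Since `b₃ ≠ 0`, every root `s` is nonzero,
so `η ↦ ηφ(η)` is locally invertible. For real `s` it also commutes with conjugation, so it is real
exactly for real `η`, that is, for `μ` on the imaginary axis. If `Δ > 0`, all three branches behave
in this way. If `Δ < 0`, a non-real root gives instead the curve that is the preimage of the real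
line, with tangent `1/s` in the `η`-plane. The conjugate root gives the mirror image of this curve
in the imaginary axis, so one of the two enters the right half-plane (`unitSpectrum_of_conj_roots`).
-/

noncomputable section

namespace GKdV

/-! ### Linear matrix differential equations -/

section MatrixODE

open Matrix

/-- Entrywise differentiability of a matrix-valued function of a real variable. -/
def HasEntryDerivAt {m n : Type*} (Y : ℝ → Matrix m n ℂ) (Y' : Matrix m n ℂ) (x : ℝ) : Prop :=
  ∀ i j, HasDerivAt (fun y => Y y i j) (Y' i j) x

namespace HasEntryDerivAt

variable {l m n : Type*} {Y Z : ℝ → Matrix m n ℂ} {Y' Z' : Matrix m n ℂ} {x : ℝ}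

theorem const (C : Matrix m n ℂ) : HasEntryDerivAt (fun _ => C) 0 x :=
  fun _ _ => hasDerivAt_const _ _

theorem mul [Fintype m] {X : ℝ → Matrix l m ℂ} {X' : Matrix l m ℂ}
    (hX : HasEntryDerivAt X X' x) (hY : HasEntryDerivAt Y Y' x) :
    HasEntryDerivAt (fun y => X y * Y y) (X' * Y x + X x * Y') x := by
  intro i j
  simp only [Matrix.mul_apply, Matrix.add_apply, ← Finset.sum_add_distrib]
  exact HasDerivAt.fun_sum fun k _ => (hX i k).mul (hY k j)

theorem transpose (hY : HasEntryDerivAt Y Y' x) : HasEntryDerivAt (fun y => (Y y)ᵀ) Y'ᵀ x :=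
  fun i j => hY j i

theorem eq_of_zero (hY : ∀ x, HasEntryDerivAt Y 0 x) (x : ℝ) : Y x = Y 0 := by
  ext i j
  exact is_const_of_deriv_eq_zero (fun x => (hY x i j).differentiableAt)
    (fun x => (hY x i j).deriv) x 0

end HasEntryDerivAt

section Fundamental

variable {A : ℝ → Matrix (Fin 3) (Fin 3) ℂ}

theorem fundamentalMatrix_zero (hA : Continuous A) : fundamentalMatrix A 0 = 1 :=
  (fundamentalMatrix_spec A hA).1

theorem hasEntryDerivAt_fundamentalMatrix (hA : Continuous A) (x : ℝ) :
    HasEntryDerivAt (fundamentalMatrix A) (A x * fundamentalMatrix A x) x :=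
  (fundamentalMatrix_spec A hA).2 x

/-- The solution of the adjoint problem `Ψ' = -Ψ A`, `Ψ 0 = 1`. -/
def adjointMatrix (A : ℝ → Matrix (Fin 3) (Fin 3) ℂ) (x : ℝ) : Matrix (Fin 3) (Fin 3) ℂ :=
  (fundamentalMatrix (fun y => -(A y)ᵀ) x)ᵀ

theorem adjointMatrix_zero (hA : Continuous A) : adjointMatrix A 0 = 1 := by
  rw [adjointMatrix, fundamentalMatrix_zero (by fun_prop), transpose_one]

theorem hasEntryDerivAt_adjointMatrix (hA : Continuous A) (x : ℝ) :
    HasEntryDerivAt (adjointMatrix A) (-(adjointMatrix A x * A x)) x := by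
  have h := (hasEntryDerivAt_fundamentalMatrix (A := fun y => -(A y)ᵀ) (by fun_prop) x).transpose
  simp only [Matrix.transpose_mul, Matrix.transpose_neg, Matrix.transpose_transpose,
    Matrix.mul_neg] at h
  exact h

/-- The terms `-ΨAY` and `ΨAY` cancel in the derivative. This conserved product yields both the
invertibility of the fundamental matrix and uniqueness, without a Grönwall estimate. -/
theorem adjointMatrix_mul_of_solution {n : Type*} (hA : Continuous A)
    {Y : ℝ → Matrix (Fin 3) n ℂ} (hY : ∀ x, HasEntryDerivAt Y (A x * Y x) x) (x : ℝ) :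
    adjointMatrix A x * Y x = Y 0 := by
  have h : ∀ x, HasEntryDerivAt (fun x => adjointMatrix A x * Y x) 0 x := fun x => by
    have := (hasEntryDerivAt_adjointMatrix hA x).mul (hY x)
    simpa [Matrix.mul_assoc] using this
  have := HasEntryDerivAt.eq_of_zero h x
  simpa [adjointMatrix_zero hA] using this

theorem adjointMatrix_mul_fundamentalMatrix (hA : Continuous A) (x : ℝ) :
    adjointMatrix A x * fundamentalMatrix A x = 1 := by
  rw [adjointMatrix_mul_of_solution hA (hasEntryDerivAt_fundamentalMatrix hA),
    fundamentalMatrix_zero hA]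

theorem fundamentalMatrix_mul_adjointMatrix (hA : Continuous A) (x : ℝ) :
    fundamentalMatrix A x * adjointMatrix A x = 1 :=
  mul_eq_one_comm.mp (adjointMatrix_mul_fundamentalMatrix hA x)

/-- Uniqueness for the linear initial value problem. -/
theorem eq_fundamentalMatrix_mul {n : Type*} (hA : Continuous A)
    {Y : ℝ → Matrix (Fin 3) n ℂ} (hY : ∀ x, HasEntryDerivAt Y (A x * Y x) x) (x : ℝ) :
    Y x = fundamentalMatrix A x * Y 0 := by
  rw [← adjointMatrix_mul_of_solution hA hY x, ← Matrix.mul_assoc,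
    fundamentalMatrix_mul_adjointMatrix hA, Matrix.one_mul]

theorem continuous_fundamentalMatrix (hA : Continuous A) : Continuous (fundamentalMatrix A) :=
  continuous_matrix fun i j => continuous_iff_continuousAt.mpr fun x =>
    (hasEntryDerivAt_fundamentalMatrix hA x i j).continuousAt

/-- Floquet's relation for a periodic coefficient matrix. -/
theorem fundamentalMatrix_add_period (hA : Continuous A) {T : ℝ} (hper : Function.Periodic A T)
    (x : ℝ) : fundamentalMatrix A (x + T) = fundamentalMatrix A x * fundamentalMatrix A T := by
  have h : ∀ x, HasEntryDerivAt (fun x => fundamentalMatrix A (x + T))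
      (A x * fundamentalMatrix A (x + T)) x := fun x i j => by
    have := (hasEntryDerivAt_fundamentalMatrix hA (x + T) i j).comp_add_const x T
    rwa [hper x] at this
  simpa using eq_fundamentalMatrix_mul hA h x

/-- Liouville's formula for a trace-free coefficient matrix. -/
theorem det_fundamentalMatrix (hA : Continuous A) (htr : ∀ x, (A x).trace = 0) (x : ℝ) :
    (fundamentalMatrix A x).det = 1 := by
  have h : ∀ x, HasDerivAt (fun x => (fundamentalMatrix A x).det) 0 x := fun x => by
    have hd := hasEntryDerivAt_fundamentalMatrix hA x
    have ht := htr x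
    simp only [Matrix.det_fin_three]
    have := ((((((((hd 0 0).mul (hd 1 1)).mul (hd 2 2)).sub (((hd 0 0).mul (hd 1 2)).mul
      (hd 2 1))).sub (((hd 0 1).mul (hd 1 0)).mul (hd 2 2))).add (((hd 0 1).mul (hd 1 2)).mul
      (hd 2 0))).add (((hd 0 2).mul (hd 1 0)).mul (hd 2 1))).sub (((hd 0 2).mul (hd 1 1)).mul
      (hd 2 0)))
    refine this.congr_deriv ?_
    simp only [Matrix.mul_apply, Fin.sum_univ_three, Matrix.trace_fin_three, Pi.mul_apply] at ht ⊢
    linear_combination (fundamentalMatrix A x).det * ht +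
      (A x 0 0 + A x 1 1 + A x 2 2) * (-(Matrix.det_fin_three (fundamentalMatrix A x)))
  have := is_const_of_deriv_eq_zero (fun x => (h x).differentiableAt) (fun x => (h x).deriv) x 0
  rw [this, fundamentalMatrix_zero hA, Matrix.det_one]

end Fundamental

/-! ### Analytic dependence on a linear parameter -/

section Parameter

/-- A linear initial value problem with a parameter in a compact set, solved in the Banach algebra
of continuous functions of the parameter. -/
theorem exists_linearODE_solution_param {𝔸 K : Type*} [NormedRing 𝔸] [NormedAlgebra ℝ 𝔸]
    [CompleteSpace 𝔸] [TopologicalSpace K] [CompactSpace K] (A : ℝ → 𝔸) (hA : Continuous A)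
    (E : C(K, 𝔸)) :
    ∃ Φ : ℝ → K → 𝔸, (Continuous fun p : ℝ × K => Φ p.1 p.2) ∧ (∀ z, Φ 0 z = 1) ∧
      ∀ z x, HasDerivAt (fun y => Φ y z) ((A x + E z) * Φ x z) x := by
  obtain ⟨Φ, h0, h⟩ := exists_linearODE_solution (fun x => ContinuousMap.const K (A x) + E)
    ((ContinuousMap.continuous_const'.comp hA).add continuous_const)
  have hΦ : Continuous Φ := continuous_iff_continuousAt.mpr fun x => (h x).continuousAt
  refine ⟨fun x => Φ x, (hΦ.comp continuous_fst).eval continuous_snd, fun z => by simp [h0],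
    fun z x => ?_⟩
  have h1 := ((ContinuousMap.evalCLM ℝ z : C(K, 𝔸) →L[ℝ] 𝔸).hasFDerivAt).comp_hasDerivAt x (h x)
  exact h1

variable {A : ℝ → Matrix (Fin 3) (Fin 3) ℂ} (E : Matrix (Fin 3) (Fin 3) ℂ)

/-- Joint continuity of the fundamental matrix in the variable and a linear parameter. -/
theorem continuous_fundamentalMatrix_param (hA : Continuous A) :
    Continuous fun p : ℂ × ℝ => fundamentalMatrix (fun x => A x + p.1 • E) p.2 := by
  let _ : NormedRing (Matrix (Fin 3) (Fin 3) ℂ) := Matrix.linftyOpNormedRing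
  let _ : NormedAlgebra ℝ (Matrix (Fin 3) (Fin 3) ℂ) := Matrix.linftyOpNormedAlgebra
  rw [continuous_iff_continuousAt]
  rintro ⟨μ, x⟩
  -- Continuity is local, so a compact ball of parameters suffices. Uniqueness identifies the
  -- solution with values in functions on `K` with the fundamental matrices.
  let K := closedBall μ 1
  have : CompactSpace K := isCompact_iff_compactSpace.mp (isCompact_closedBall μ 1)
  obtain ⟨Φ, hΦ, h0, h⟩ := exists_linearODE_solution_param A hA
    (⟨fun z : K => (z : ℂ) • E, by fun_prop⟩ : C(K, Matrix (Fin 3) (Fin 3) ℂ))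
  have hev : ∀ (z : K) (x : ℝ), Φ x z = fundamentalMatrix (fun x => A x + (z : ℂ) • E) x := by
    intro z x
    have hs : ∀ x, HasEntryDerivAt (fun x => Φ x z) ((A x + (z : ℂ) • E) * Φ x z) x :=
      fun x i j =>
        ((Matrix.entryLinearMap ℝ ℂ i j).toContinuousLinearMap.hasFDerivAt).comp_hasDerivAt
          x (h z x)
    have := eq_fundamentalMatrix_mul (A := fun x => A x + (z : ℂ) • E) (by fun_prop) hs x
    simpa [h0] using this
  have hc : ContinuousOn (fun p : ℂ × ℝ => fundamentalMatrix (fun x => A x + p.1 • E) p.2)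
      (K ×ˢ univ) := by
    rw [continuousOn_iff_continuous_domRestrict]
    have h2 : Continuous fun p : (K ×ˢ (univ : Set ℝ) : Set (ℂ × ℝ)) =>
        Φ p.1.2 ⟨p.1.1, p.2.1⟩ :=
      hΦ.comp (by fun_prop : Continuous fun p : (K ×ˢ (univ : Set ℝ) : Set (ℂ × ℝ)) =>
        ((p.1.2, ⟨p.1.1, p.2.1⟩) : ℝ × K))
    refine h2.congr fun p => ?_
    rw [hev]
    rfl
  exact hc.continuousAt (prod_mem_nhds (closedBall_mem_nhds μ one_pos) Filter.univ_mem)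

theorem continuous_adjointMatrix_param (hA : Continuous A) :
    Continuous fun p : ℂ × ℝ => adjointMatrix (fun x => A x + p.1 • E) p.2 := by
  have h := (continuous_fundamentalMatrix_param (A := fun x => -(A x)ᵀ) (-Eᵀ)
    (by fun_prop)).matrix_transpose
  refine h.congr fun p => ?_
  simp only [adjointMatrix, transpose_add, transpose_smul, neg_add, smul_neg]

/-- Duhamel's formula for the dependence on a linear parameter. -/
theorem fundamentalMatrix_param_sub (hA : Continuous A) (μ ν : ℂ) (x : ℝ) (i j : Fin 3) :
    (adjointMatrix (fun x => A x + ν • E) x * fundamentalMatrix (fun x => A x + μ • E) x) i j =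
      (1 : Matrix (Fin 3) (Fin 3) ℂ) i j + (μ - ν) * ∫ s in (0 : ℝ)..x,
        (adjointMatrix (fun x => A x + ν • E) s * E *
          fundamentalMatrix (fun x => A x + μ • E) s) i j := by
  have hμ : Continuous fun x => A x + μ • E := by fun_prop
  have hν : Continuous fun x => A x + ν • E := by fun_prop
  have hc1 : Continuous (adjointMatrix (fun x => A x + ν • E)) :=
    (continuous_fundamentalMatrix (A := fun x => -(A x + ν • E)ᵀ) (by fun_prop)).matrix_transpose
  have hc2 := continuous_fundamentalMatrix hμ
  have hd : ∀ s, HasDerivAt (fun s => (adjointMatrix (fun x => A x + ν • E) s *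
      fundamentalMatrix (fun x => A x + μ • E) s) i j)
      ((μ - ν) * (adjointMatrix (fun x => A x + ν • E) s * E *
          fundamentalMatrix (fun x => A x + μ • E) s) i j) s := fun s => by
    have := ((hasEntryDerivAt_adjointMatrix hν s).mul (hasEntryDerivAt_fundamentalMatrix hμ s)) i j
    refine this.congr_deriv ?_
    have key : ∀ X Y : Matrix (Fin 3) (Fin 3) ℂ, -(X * (A s + ν • E)) * Y +
        X * ((A s + μ • E) * Y) = (μ - ν) • (X * E * Y) := fun X Y => by
      simp only [Matrix.mul_add, Matrix.add_mul, Matrix.mul_smul, Matrix.smul_mul, Matrix.neg_mul,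
        sub_smul, Matrix.mul_assoc]
      abel
    exact congrFun (congrFun (key _ _) i) j
  have := intervalIntegral.integral_eq_sub_of_hasDerivAt (fun s _ => hd s) (a := 0) (b := x)
    (Continuous.intervalIntegrable (by fun_prop) _ _)
  rw [intervalIntegral.integral_const_mul] at this
  rw [this, adjointMatrix_zero hν, fundamentalMatrix_zero hμ]
  simp

/-- By Duhamel's formula the difference quotient at `ν`, after multiplication by the inverse flow at
`ν`, is an integral depending continuously on `μ`, so its limit exists. -/
theorem differentiable_fundamentalMatrix_param (hA : Continuous A) (x : ℝ) (i j : Fin 3) :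
    Differentiable ℂ fun μ : ℂ => fundamentalMatrix (fun x => A x + μ • E) x i j := by
  intro ν
  have hcont : ∀ i j : Fin 3, Continuous fun μ : ℂ => ∫ s in (0 : ℝ)..x,
      (adjointMatrix (fun x => A x + ν • E) s * E *
        fundamentalMatrix (fun x => A x + μ • E) s) i j := fun i j => by
    have h1 : Continuous fun p : ℂ × ℝ => adjointMatrix (fun x => A x + ν • E) p.2 := by
      have hc : Continuous fun p : ℂ × ℝ => (ν, p.2) := by fun_prop
      have h0 := (continuous_adjointMatrix_param E hA).comp hc
      exact h0
    have h2 := continuous_fundamentalMatrix_param E hA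
    have h3 : ∀ X Y : ℂ → ℝ → Matrix (Fin 3) (Fin 3) ℂ, Continuous (fun p : ℂ × ℝ => X p.1 p.2) →
        Continuous (fun p : ℂ × ℝ => Y p.1 p.2) →
        Continuous fun μ : ℂ => ∫ s in (0 : ℝ)..x, (X μ s * E * Y μ s) i j := fun X Y hX hY =>
      intervalIntegral.continuous_parametric_intervalIntegral_of_continuous'
        (f := fun μ s => (X μ s * E * Y μ s) i j)
        (((hX.matrix_mul continuous_const).matrix_mul hY).matrix_elem i j) 0 x
    exact h3 (fun _ s => adjointMatrix (fun x => A x + ν • E) s)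
      (fun μ s => fundamentalMatrix (fun x => A x + μ • E) s) h1 h2
  have hν : Continuous fun x => A x + ν • E := by fun_prop
  have hW : ∀ i j, DifferentiableAt ℂ (fun μ : ℂ => (adjointMatrix (fun x => A x + ν • E) x *
      fundamentalMatrix (fun x => A x + μ • E) x) i j) ν := fun i j => by
    simp only [fundamentalMatrix_param_sub E hA]
    refine (DifferentiableAt.const_add _ ?_)
    refine HasDerivAt.differentiableAt (f' := ∫ s in (0 : ℝ)..x,
      (adjointMatrix (fun x => A x + ν • E) s * E *
        fundamentalMatrix (fun x => A x + ν • E) s) i j) (hasDerivAt_iff_tendsto_slope.mpr ?_)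
    refine (((hcont i j).tendsto ν).mono_left nhdsWithin_le_nhds).congr' ?_
    filter_upwards [self_mem_nhdsWithin] with μ hμ
    have : μ - ν ≠ 0 := sub_ne_zero.mpr hμ
    simp [slope_def_field, this]
  have heq : ∀ μ : ℂ, fundamentalMatrix (fun x => A x + μ • E) x =
      fundamentalMatrix (fun x => A x + ν • E) x * (adjointMatrix (fun x => A x + ν • E) x *
        fundamentalMatrix (fun x => A x + μ • E) x) := fun μ => by
    rw [← Matrix.mul_assoc, fundamentalMatrix_mul_adjointMatrix hν, Matrix.one_mul]
  have : (fun μ : ℂ => fundamentalMatrix (fun x => A x + μ • E) x i j) = fun μ : ℂ =>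
      ∑ k, fundamentalMatrix (fun x => A x + ν • E) x i k *
        (adjointMatrix (fun x => A x + ν • E) x *
          fundamentalMatrix (fun x => A x + μ • E) x) k j := by
    funext μ
    conv_lhs => rw [heq μ, Matrix.mul_apply]
  rw [this]
  exact DifferentiableAt.fun_sum fun k _ => (hW k j).const_mul _

end Parameter

end MatrixODE

/-! ### The reduced system and the symmetries of its monodromy -/

section ReducedSystem

open Matrix

section Reduced

/-- The coefficient matrix of `∂ₓ𝓛 ψ = μ ψ`, `𝓛 = -∂ₓ² + q`, as a first-order system for
`(ψ, ψ', 𝓛ψ)`. -/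
def reducedMatrix (q : ℝ → ℝ) (μ : ℂ) (x : ℝ) : Matrix (Fin 3) (Fin 3) ℂ :=
  !![0, 1, 0; (q x : ℂ), 0, -1; μ, 0, 0]

variable {q : ℝ → ℝ}

theorem reducedMatrix_eq_add_smul (q : ℝ → ℝ) (μ : ℂ) :
    reducedMatrix q μ = fun x => reducedMatrix q 0 x + μ • !![0, 0, 0; 0, 0, 0; 1, 0, 0] := by
  funext x
  ext i j
  fin_cases i <;> fin_cases j <;> simp [reducedMatrix]

theorem continuous_reducedMatrix (hq : Continuous q) (μ : ℂ) : Continuous (reducedMatrix q μ) := by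
  refine continuous_matrix fun i j => ?_
  fin_cases i <;> fin_cases j <;> simp [reducedMatrix] <;> fun_prop

/-- The monodromy matrix of the reduced system. -/
def reducedMonodromy (q : ℝ → ℝ) (T : ℝ) (μ : ℂ) : Matrix (Fin 3) (Fin 3) ℂ :=
  fundamentalMatrix (reducedMatrix q μ) T

theorem differentiable_reducedMonodromy (hq : Continuous q) (T : ℝ) (i j : Fin 3) :
    Differentiable ℂ fun μ => reducedMonodromy q T μ i j := by
  have := differentiable_fundamentalMatrix_param !![0, 0, 0; 0, 0, 0; 1, 0, 0]
    (continuous_reducedMatrix hq 0) T i j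
  simpa only [reducedMonodromy, ← reducedMatrix_eq_add_smul] using this

theorem det_reducedMonodromy (hq : Continuous q) (T : ℝ) (μ : ℂ) :
    (reducedMonodromy q T μ).det = 1 :=
  det_fundamentalMatrix (continuous_reducedMatrix hq μ)
    (fun x => by simp [Matrix.trace_fin_three, reducedMatrix]) T

/-- Since `q` is real, conjugating a solution for `μ` gives a solution for `conj μ`. -/
theorem reducedMonodromy_conj (hq : Continuous q) (T : ℝ) (μ : ℂ) :
    reducedMonodromy q T (conj μ) = (reducedMonodromy q T μ).map conj := by
  have hs : ∀ x, HasEntryDerivAt (fun x => (fundamentalMatrix (reducedMatrix q μ) x).map conj)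
      (reducedMatrix q (conj μ) x * (fundamentalMatrix (reducedMatrix q μ) x).map conj) x :=
    fun x i j => by
      have h := (hasEntryDerivAt_fundamentalMatrix (continuous_reducedMatrix hq μ) x i j).star
      refine h.congr_deriv ?_
      rw [Matrix.mul_apply, Matrix.mul_apply, star_sum]
      refine Finset.sum_congr rfl fun k _ => ?_
      rw [star_mul', Matrix.map_apply]
      congr 1
      fin_cases i <;> fin_cases k <;> simp [reducedMatrix]
  have := eq_fundamentalMatrix_mul (continuous_reducedMatrix hq (conj μ)) hs T
  rw [reducedMonodromy, reducedMonodromy, this,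
    fundamentalMatrix_zero (continuous_reducedMatrix hq μ)]
  simp [Matrix.map_one]

theorem trace_reducedMonodromy_conj (hq : Continuous q) (T : ℝ) (μ : ℂ) :
    (reducedMonodromy q T (conj μ)).trace = conj (reducedMonodromy q T μ).trace := by
  rw [reducedMonodromy_conj hq]
  simp [Matrix.trace_fin_three]

/-- The bilinear form that is invariant under the flow. -/
theorem reducedMonodromy_transpose_mul (hq : Continuous q) (T : ℝ) (μ : ℂ) :
    (reducedMonodromy q T (-μ))ᵀ * !![0, -μ, 0; μ, 0, 0; 0, 0, 1] * reducedMonodromy q T μ =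
      !![0, -μ, 0; μ, 0, 0; 0, 0, 1] := by
  have h : ∀ x, HasEntryDerivAt (fun x => (fundamentalMatrix (reducedMatrix q (-μ)) x)ᵀ *
      !![0, -μ, 0; μ, 0, 0; 0, 0, 1] * fundamentalMatrix (reducedMatrix q μ) x) 0 x := fun x => by
    have h1 := ((hasEntryDerivAt_fundamentalMatrix
      (continuous_reducedMatrix hq (-μ)) x).transpose.mul (HasEntryDerivAt.const
      !![0, -μ, 0; μ, 0, 0; 0, 0, 1])).mul
      (hasEntryDerivAt_fundamentalMatrix (continuous_reducedMatrix hq μ) x)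
    have h2 : (reducedMatrix q (-μ) x)ᵀ * !![0, -μ, 0; μ, 0, 0; 0, 0, 1] +
        !![0, -μ, 0; μ, 0, 0; 0, 0, 1] * reducedMatrix q μ x = 0 := by
      ext i j
      fin_cases i <;> fin_cases j <;>
        simp [reducedMatrix, Matrix.mul_apply, Fin.sum_univ_three, Matrix.vecHead,
          Matrix.vecTail, mul_comm]
    generalize hJ : (!![0, -μ, 0; μ, 0, 0; 0, 0, 1] : Matrix (Fin 3) (Fin 3) ℂ) = J at *
    have h3 : ∀ X Y : Matrix (Fin 3) (Fin 3) ℂ,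
        ((reducedMatrix q (-μ) x * X)ᵀ * J + Xᵀ * 0) * Y + Xᵀ * J * (reducedMatrix q μ x * Y) = 0 :=
      fun X Y => by
        have : ((reducedMatrix q (-μ) x * X)ᵀ * J + Xᵀ * 0) * Y +
            Xᵀ * J * (reducedMatrix q μ x * Y) =
            Xᵀ * ((reducedMatrix q (-μ) x)ᵀ * J + J * reducedMatrix q μ x) * Y := by
          simp only [Matrix.transpose_mul, Matrix.mul_add, Matrix.add_mul, Matrix.mul_assoc,
            Matrix.mul_zero, add_zero]
        rw [this, h2, Matrix.mul_zero, Matrix.zero_mul]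
    rw [h3] at h1
    exact h1
  have := HasEntryDerivAt.eq_of_zero h T
  rw [fundamentalMatrix_zero (continuous_reducedMatrix hq μ),
    fundamentalMatrix_zero (continuous_reducedMatrix hq (-μ))] at this
  simpa [reducedMonodromy] using this

theorem continuous_trace_reducedMonodromy (hq : Continuous q) (T : ℝ) :
    Continuous fun μ => (reducedMonodromy q T μ).trace :=
  (continuous_matrix fun i j =>
    (differentiable_reducedMonodromy hq T i j).continuous).matrix_trace

/-- The determinant is one, so the adjugate is the inverse. When the invariant form is
nondegenerate, it conjugates this inverse to the transpose of the monodromy at `-μ`. -/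
theorem trace_adjugate_reducedMonodromy (hq : Continuous q) (T : ℝ) (μ : ℂ) :
    (reducedMonodromy q T μ).adjugate.trace = (reducedMonodromy q T (-μ)).trace := by
  have hne : ∀ μ : ℂ, μ ≠ 0 →
      (reducedMonodromy q T μ).adjugate.trace = (reducedMonodromy q T (-μ)).trace := by
    intro μ hμ
    have h := reducedMonodromy_transpose_mul hq T μ
    have hJ : (!![0, -μ, 0; μ, 0, 0; 0, 0, 1] : Matrix (Fin 3) (Fin 3) ℂ) *
        !![0, μ⁻¹, 0; -μ⁻¹, 0, 0; 0, 0, 1] = 1 := by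
      ext i j
      fin_cases i <;> fin_cases j <;>
        simp [Matrix.mul_apply, Fin.sum_univ_three, hμ]
    generalize (!![0, -μ, 0; μ, 0, 0; 0, 0, 1] : Matrix (Fin 3) (Fin 3) ℂ) = J at *
    generalize (!![0, μ⁻¹, 0; -μ⁻¹, 0, 0; 0, 0, 1] : Matrix (Fin 3) (Fin 3) ℂ) = K at *
    have hK := mul_eq_one_comm.mp hJ
    have hadj : reducedMonodromy q T μ * (reducedMonodromy q T μ).adjugate = 1 := by
      rw [Matrix.mul_adjugate, det_reducedMonodromy hq, one_smul]
    calc (reducedMonodromy q T μ).adjugate.trace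
        = (K * (J * (reducedMonodromy q T μ).adjugate)).trace := by
          rw [← Matrix.mul_assoc, hK, Matrix.one_mul]
      _ = (K * ((reducedMonodromy q T (-μ))ᵀ * J)).trace := by
          congr 2
          conv_lhs => rw [← h]
          rw [Matrix.mul_assoc, hadj, Matrix.mul_one]
      _ = _ := by
          rw [Matrix.trace_mul_comm, Matrix.mul_assoc, hJ, Matrix.mul_one, Matrix.trace_transpose]
  -- The form degenerates at `μ = 0`; the identity extends there by continuity.
  by_cases hμ : μ = 0
  · subst hμ
    have hc := continuous_matrix fun i j => (differentiable_reducedMonodromy hq T i j).continuous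
    have h1 : Continuous fun μ => (reducedMonodromy q T μ).adjugate.trace :=
      hc.matrix_adjugate.matrix_trace
    have h2 : Continuous fun μ => (reducedMonodromy q T (-μ)).trace :=
      (continuous_trace_reducedMonodromy hq T).comp continuous_neg
    have h3 : ∀ᶠ μ in nhdsWithin (0 : ℂ) {0}ᶜ, (reducedMonodromy q T μ).adjugate.trace =
        (reducedMonodromy q T (-μ)).trace := by
      filter_upwards [self_mem_nhdsWithin] with μ hμ using hne μ hμ
    exact tendsto_nhds_unique ((h1.tendsto 0).mono_left nhdsWithin_le_nhds)
      (((h2.tendsto 0).mono_left nhdsWithin_le_nhds).congr' (h3.mono fun _ h => h.symm))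
  · exact hne μ hμ

theorem eval_charpoly_fin_three (M : Matrix (Fin 3) (Fin 3) ℂ) (z : ℂ) :
    M.charpoly.eval z = z ^ 3 - M.trace * z ^ 2 + M.adjugate.trace * z - M.det := by
  rw [Matrix.eval_charpoly, Matrix.trace_fin_three, Matrix.trace_fin_three,
    Matrix.adjugate_fin_three, Matrix.det_fin_three, Matrix.det_fin_three]
  simp [Matrix.scalar_apply]
  ring

/-- The characteristic polynomial of the monodromy matrix is determined by its trace. -/
theorem eval_charpoly_reducedMonodromy (hq : Continuous q) (T : ℝ) (μ z : ℂ) :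
    (reducedMonodromy q T μ).charpoly.eval z = z ^ 3 - (reducedMonodromy q T μ).trace * z ^ 2
      + (reducedMonodromy q T (-μ)).trace * z - 1 := by
  rw [eval_charpoly_fin_three, trace_adjugate_reducedMonodromy hq, det_reducedMonodromy hq]

end Reduced

end ReducedSystem

/-! ### The trace of the monodromy to first order at the origin -/

section TraceExpansion

open Matrix

section Expansion

variable {q : ℝ → ℝ}

theorem reducedMonodromy_third_row (hq : Continuous q) (T : ℝ) (μ : ℂ) (j : Fin 3) :
    reducedMonodromy q T μ 2 j = (1 : Matrix (Fin 3) (Fin 3) ℂ) 2 j +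
      μ * ∫ s in (0 : ℝ)..T, fundamentalMatrix (reducedMatrix q μ) s 0 j := by
  have hA := continuous_reducedMatrix hq μ
  have hd : ∀ s, HasDerivAt (fun s => fundamentalMatrix (reducedMatrix q μ) s 2 j)
      (μ * fundamentalMatrix (reducedMatrix q μ) s 0 j) s := fun s => by
    refine (hasEntryDerivAt_fundamentalMatrix hA s 2 j).congr_deriv ?_
    simp [Matrix.mul_apply, Fin.sum_univ_three, reducedMatrix]
  have hc := (continuous_fundamentalMatrix hA).matrix_elem 0 j
  have := intervalIntegral.integral_eq_sub_of_hasDerivAt (fun s _ => hd s) (a := 0) (b := T)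
    (Continuous.intervalIntegrable (by fun_prop) _ _)
  rw [intervalIntegral.integral_const_mul, fundamentalMatrix_zero hA] at this
  rw [this, reducedMonodromy]
  ring

/-- The third component has derivative `μ` times the first, so the difference quotient at `0` is
exactly an integral of the first row, continuous in `μ`. -/
theorem hasDerivAt_reducedMonodromy_third_row (hq : Continuous q) (T : ℝ) (j : Fin 3) :
    HasDerivAt (fun μ => reducedMonodromy q T μ 2 j)
      (∫ s in (0 : ℝ)..T, fundamentalMatrix (reducedMatrix q 0) s 0 j) 0 := by
  have h1 := (continuous_fundamentalMatrix_param !![0, 0, 0; 0, 0, 0; 1, 0, 0]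
    (continuous_reducedMatrix hq 0)).matrix_elem 0 j
  simp only [← reducedMatrix_eq_add_smul] at h1
  have h2 := intervalIntegral.continuous_parametric_intervalIntegral_of_continuous'
    (f := fun μ s => fundamentalMatrix (reducedMatrix q μ) s 0 j) h1 0 T
    (μ := MeasureTheory.volume)
  rw [hasDerivAt_iff_tendsto_slope]
  refine ((h2.tendsto 0).mono_left nhdsWithin_le_nhds).congr' ?_
  filter_upwards [self_mem_nhdsWithin] with μ hμ
  have hμ' : μ ≠ 0 := hμ
  rw [slope_def_field, reducedMonodromy_third_row hq, reducedMonodromy_third_row hq T 0]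
  field_simp
  ring

theorem mul_eq_mul_of_common_kernel {a b c d v w : ℂ} (hvw : v ≠ 0 ∨ w ≠ 0)
    (h1 : a * v + b * w = 0) (h2 : c * v + d * w = 0) : a * d = b * c := by
  rcases hvw with h | h
  · exact mul_right_cancel₀ h (by linear_combination d * h1 - b * h2)
  · exact mul_right_cancel₀ h (by linear_combination a * h2 - c * h1)

variable {p p' : ℝ → ℝ} {T : ℝ}

/-- A solution of `p'' = q p` satisfies `𝓛p = 0`, so `(p, p', 0)` solves the reduced system at `μ =
0`. -/
theorem fundamentalMatrix_reducedMatrix_zero_mulVec (hq : Continuous q)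
    (hp : ∀ x, HasDerivAt p (p' x) x) (hp' : ∀ x, HasDerivAt p' (q x * p x) x) (x : ℝ) :
    (p x : ℂ) = fundamentalMatrix (reducedMatrix q 0) x 0 0 * p 0 +
        fundamentalMatrix (reducedMatrix q 0) x 0 1 * p' 0 ∧
      (p' x : ℂ) = fundamentalMatrix (reducedMatrix q 0) x 1 0 * p 0 +
        fundamentalMatrix (reducedMatrix q 0) x 1 1 * p' 0 := by
  have h : ∀ x, HasEntryDerivAt (fun x => replicateCol Unit ![(p x : ℂ), (p' x : ℂ), 0])
      (reducedMatrix q 0 x * replicateCol Unit ![(p x : ℂ), (p' x : ℂ), 0]) x := fun x i j => by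
    rw [Matrix.mul_apply, Fin.sum_univ_three]
    fin_cases i
    · exact (hp x).ofReal_comp.congr_deriv (by simp [reducedMatrix])
    · exact (hp' x).ofReal_comp.congr_deriv (by simp [reducedMatrix])
    · exact (hasDerivAt_const x (0 : ℂ)).congr_deriv (by simp [reducedMatrix])
  have h1 := eq_fundamentalMatrix_mul (continuous_reducedMatrix hq 0) h x
  have h2 := congrFun (congrFun h1 0) ()
  have h3 := congrFun (congrFun h1 1) ()
  rw [Matrix.mul_apply, Fin.sum_univ_three] at h2 h3
  refine ⟨h2.trans ?_, h3.trans ?_⟩ <;> simp [replicateCol_apply]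

/-- At `μ = 0` the third row is `(0, 0, 1)`, and the upper left block has determinant one and fixes
`(p 0, p' 0)`; its trace is therefore 2. For the derivative, `det (1 - N μ)` is differentiated in
two ways. The characteristic polynomial at 1 gives `-2` times the derivative of the trace. The
determinant gives zero: only the third row needs differentiating, and since `p` has mean zero the
resulting matrix still kills `(p 0, p' 0, 0)`. -/
theorem trace_reducedMonodromy_expansion (hq : Continuous q)
    (hp : ∀ x, HasDerivAt p (p' x) x) (hp' : ∀ x, HasDerivAt p' (q x * p x) x)
    (hT : p T = p 0) (hT' : p' T = p' 0) (hint : ∫ x in (0 : ℝ)..T, p x = 0)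
    (hne : p 0 ≠ 0 ∨ p' 0 ≠ 0) :
    (reducedMonodromy q T 0).trace = 3 ∧
      HasDerivAt (fun μ => (reducedMonodromy q T μ).trace) 0 0 := by
  have hv : (p 0 : ℂ) ≠ 0 ∨ (p' 0 : ℂ) ≠ 0 := by simpa using hne
  obtain ⟨e1, e2⟩ := fundamentalMatrix_reducedMatrix_zero_mulVec hq hp hp' T
  rw [hT] at e1
  rw [hT'] at e2
  have r0 := reducedMonodromy_third_row hq T 0 0
  have r1 := reducedMonodromy_third_row hq T 0 1
  have r2 := reducedMonodromy_third_row hq T 0 2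
  have hdet := det_reducedMonodromy hq T 0
  rw [Matrix.det_fin_three] at hdet
  change (p 0 : ℂ) = reducedMonodromy q T 0 0 0 * _ + reducedMonodromy q T 0 0 1 * _ at e1
  change (p' 0 : ℂ) = reducedMonodromy q T 0 1 0 * _ + reducedMonodromy q T 0 1 1 * _ at e2
  simp only [zero_mul, add_zero, Matrix.one_apply_eq,
    Matrix.one_apply_ne (by decide : (2 : Fin 3) ≠ 0),
    Matrix.one_apply_ne (by decide : (2 : Fin 3) ≠ 1)] at r0 r1 r2
  have hc := fun j => hasDerivAt_reducedMonodromy_third_row hq T j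
  set N := reducedMonodromy q T with hN
  have k1 : (N 0 0 0 - 1) * p 0 + N 0 0 1 * p' 0 = 0 := by linear_combination -e1
  have k2 : N 0 1 0 * p 0 + (N 0 1 1 - 1) * p' 0 = 0 := by linear_combination -e2
  have hb := mul_eq_mul_of_common_kernel hv k1 k2
  rw [r0, r1, r2] at hdet
  have htr0 : (N 0).trace = 3 := by
    rw [Matrix.trace_fin_three, r2]
    linear_combination hdet - hb
  refine ⟨htr0, ?_⟩
  have k3 : (∫ s in (0 : ℝ)..T, fundamentalMatrix (reducedMatrix q 0) s 0 0) * p 0 +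
      (∫ s in (0 : ℝ)..T, fundamentalMatrix (reducedMatrix q 0) s 0 1) * p' 0 = 0 := by
    have hcont := fun j => (continuous_fundamentalMatrix
      (continuous_reducedMatrix hq 0)).matrix_elem 0 j
    have hadd := intervalIntegral.integral_add (μ := MeasureTheory.volume)
      (((hcont 0).mul_const (p 0 : ℂ)).intervalIntegrable 0 T)
      (((hcont 1).mul_const (p' 0 : ℂ)).intervalIntegrable 0 T)
    rw [intervalIntegral.integral_mul_const, intervalIntegral.integral_mul_const] at hadd
    rw [← hadd]
    have : ∀ s, fundamentalMatrix (reducedMatrix q 0) s 0 0 * p 0 +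
        fundamentalMatrix (reducedMatrix q 0) s 0 1 * p' 0 = (p s : ℂ) := fun s =>
      (fundamentalMatrix_reducedMatrix_zero_mulVec hq hp hp' s).1.symm
    simp only [this, intervalIntegral.integral_ofReal, hint, Complex.ofReal_zero]
  have hb2 := mul_eq_mul_of_common_kernel hv k1 k3
  have hb3 := mul_eq_mul_of_common_kernel hv k2 k3
  have hdiff : ∀ i j, HasDerivAt (fun μ => N μ i j) (deriv (fun μ => N μ i j) 0) 0 := fun i j =>
    (differentiable_reducedMonodromy hq T i j 0).hasDerivAt
  have htr : HasDerivAt (fun μ => (N μ).trace) (deriv (fun μ => (N μ).trace) 0) 0 := by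
    refine DifferentiableAt.hasDerivAt ?_
    simp only [Matrix.trace_fin_three]
    exact ((hdiff 0 0).differentiableAt.add (hdiff 1 1).differentiableAt).add
      (hdiff 2 2).differentiableAt
  have hD1 : HasDerivAt (fun μ => (1 - N μ).det) (-2 * deriv (fun μ => (N μ).trace) 0) 0 := by
    have h1 : ∀ μ, (1 - N μ).det = (N (-μ)).trace - (N μ).trace := fun μ => by
      have := eval_charpoly_reducedMonodromy hq T μ 1
      rw [Matrix.eval_charpoly] at this
      simp only [map_one] at this
      rw [this]
      ring
    have htrn : HasDerivAt (fun μ => (N μ).trace) (deriv (fun μ => (N μ).trace) 0) (-0) := by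
      simpa using htr
    have h2 := (htrn.comp (0 : ℂ) (hasDerivAt_neg (0 : ℂ))).sub htr
    refine (h2.congr_deriv (by ring)).congr_of_eventuallyEq (Filter.Eventually.of_forall h1)
  have hD2 : HasDerivAt (fun μ => (1 - N μ).det) 0 0 := by
    simp only [Matrix.det_fin_three]
    have hd : ∀ i j, HasDerivAt (fun μ => (1 - N μ) i j) (-deriv (fun μ => N μ i j) 0) 0 :=
      fun i j => by
        simpa using (hdiff i j).const_sub ((1 : Matrix (Fin 3) (Fin 3) ℂ) i j)
    have hd2 : ∀ j, HasDerivAt (fun μ => (1 - N μ) 2 j)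
        (-(∫ s in (0 : ℝ)..T, fundamentalMatrix (reducedMatrix q 0) s 0 j)) 0 :=
      fun j => by
        simpa using (hc j).const_sub ((1 : Matrix (Fin 3) (Fin 3) ℂ) 2 j)
    have := ((((((((hd 0 0).mul (hd 1 1)).mul (hd2 2)).sub (((hd 0 0).mul (hd 1 2)).mul
      (hd2 1))).sub (((hd 0 1).mul (hd 1 0)).mul (hd2 2))).add (((hd 0 1).mul (hd 1 2)).mul
      (hd2 0))).add (((hd 0 2).mul (hd 1 0)).mul (hd2 1))).sub (((hd 0 2).mul (hd 1 1)).mul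
      (hd2 0)))
    refine this.congr_deriv ?_
    simp only [Pi.mul_apply, Matrix.sub_apply, r0, r1, r2, Matrix.one_apply_eq,
      Matrix.one_apply_ne (by decide : (2 : Fin 3) ≠ 0),
      Matrix.one_apply_ne (by decide : (2 : Fin 3) ≠ 1),
      Matrix.one_apply_ne (by decide : (0 : Fin 3) ≠ 1),
      Matrix.one_apply_ne (by decide : (0 : Fin 3) ≠ 2),
      Matrix.one_apply_ne (by decide : (1 : Fin 3) ≠ 0),
      Matrix.one_apply_ne (by decide : (1 : Fin 3) ≠ 2)]
    linear_combination (-(∫ s in (0 : ℝ)..T, fundamentalMatrix (reducedMatrix q 0) s 0 2)) * hb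
      + N 0 1 2 * hb2 - N 0 0 2 * hb3
  have := hD1.unique hD2
  have h0 : deriv (fun μ => (N μ).trace) 0 = 0 := by simpa using this
  rwa [h0] at htr

end Expansion

end TraceExpansion

/-! ### Bounded solutions and unimodular multipliers -/

section FloquetTheory

open Matrix

section Floquet

theorem hasDerivAt_fundamentalMatrix_mulVec {A : ℝ → Matrix (Fin 3) (Fin 3) ℂ} (hA : Continuous A)
    (v : Fin 3 → ℂ) (x : ℝ) (i : Fin 3) :
    HasDerivAt (fun y => (fundamentalMatrix A y *ᵥ v) i)
      ((A x *ᵥ (fundamentalMatrix A x *ᵥ v)) i) x := by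
  rw [Matrix.mulVec_mulVec]
  simp only [Matrix.mulVec, dotProduct]
  exact HasDerivAt.fun_sum fun k _ => (hasEntryDerivAt_fundamentalMatrix hA x i k).mul_const (v k)

theorem eq_fundamentalMatrix_mulVec {A : ℝ → Matrix (Fin 3) (Fin 3) ℂ} (hA : Continuous A)
    {w : ℝ → Fin 3 → ℂ} (hw : ∀ x i, HasDerivAt (fun y => w y i) ((A x *ᵥ w x) i) x) (x : ℝ) :
    w x = fundamentalMatrix A x *ᵥ w 0 := by
  have h := eq_fundamentalMatrix_mul hA (Y := fun x => replicateCol Unit (w x))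
    (fun x i _ => hw x i) x
  funext i
  exact congrFun (congrFun h i) ()

/-- A bounded Floquet solution has a multiplier of modulus one. -/
theorem norm_multiplier_eq_one {g : ℝ → ℂ} {z : ℂ} {T C x₀ : ℝ} (hz : z ≠ 0)
    (hg : ∀ x, g (x + T) = z * g x) (hC : ∀ x, ‖g x‖ ≤ C) (h0 : g x₀ ≠ 0) : ‖z‖ = 1 := by
  have key : ∀ (w : ℂ) (S : ℝ), (∀ x, g (x + S) = w * g x) → ‖w‖ ≤ 1 := by
    intro w S h
    have hpow : ∀ n : ℕ, g (x₀ + n * S) = w ^ n * g x₀ := by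
      intro n
      induction n with
      | zero => simp
      | succ n ih =>
        rw [show x₀ + ((n + 1 : ℕ) : ℝ) * S = (x₀ + n * S) + S by push_cast; ring, h, ih]
        ring
    by_contra! hw
    obtain ⟨n, hn⟩ := pow_unbounded_of_one_lt (C / ‖g x₀‖) hw
    have h1 := hC (x₀ + n * S)
    rw [hpow, norm_mul, norm_pow] at h1
    rw [div_lt_iff₀ (norm_pos_iff.mpr h0)] at hn
    linarith
  refine le_antisymm (key z T hg) ?_
  -- The same growth bound for the backward shift gives the reverse inequality.
  have h1 := key z⁻¹ (-T) fun x => by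
    have := hg (x + -T)
    rw [neg_add_cancel_right] at this
    rw [this, inv_mul_cancel_left₀ hz]
  rw [norm_inv] at h1
  exact (inv_le_one₀ (norm_pos_iff.mpr hz)).mp h1

variable {q : ℝ → ℝ}

theorem reducedMatrix_mulVec (q : ℝ → ℝ) (μ : ℂ) (x : ℝ) (w : Fin 3 → ℂ) :
    reducedMatrix q μ x *ᵥ w = ![w 1, q x * w 0 - w 2, μ * w 0] := by
  funext i
  fin_cases i <;> simp [reducedMatrix, Matrix.mulVec, dotProduct, Fin.sum_univ_three]; ring

/-- The first component determines the other two: if it vanishes identically, the first equation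
kills the second component and the second equation kills the third. -/
theorem exists_ne_zero_of_initial_ne_zero (hq : Continuous q) (μ : ℂ) {v : Fin 3 → ℂ}
    (hv : v ≠ 0) : ∃ x, (fundamentalMatrix (reducedMatrix q μ) x *ᵥ v) 0 ≠ 0 := by
  by_contra! h
  have hd := hasDerivAt_fundamentalMatrix_mulVec (continuous_reducedMatrix hq μ) v
  simp only [reducedMatrix_mulVec] at hd
  have h1 : ∀ x, (fundamentalMatrix (reducedMatrix q μ) x *ᵥ v) 1 = 0 := fun x => by
    have h2 := hd x 0
    simp only [h] at h2
    simpa using h2.unique (hasDerivAt_const x (0 : ℂ))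
  have h2 : ∀ x, (fundamentalMatrix (reducedMatrix q μ) x *ᵥ v) 2 = 0 := fun x => by
    have h3 := hd x 1
    simp only [h1, h] at h3
    simpa using h3.unique (hasDerivAt_const x (0 : ℂ))
  refine hv (funext fun i => ?_)
  have h3 : fundamentalMatrix (reducedMatrix q μ) 0 *ᵥ v = v := by
    rw [fundamentalMatrix_zero (continuous_reducedMatrix hq μ), Matrix.one_mulVec]
  rw [← h3]
  fin_cases i
  · exact h 0
  · exact h1 0
  · exact h2 0

theorem fundamentalMatrix_mulVec_add_period (hq : Continuous q) {T : ℝ}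
    (hper : Function.Periodic q T) (μ : ℂ) (v : Fin 3 → ℂ) (x : ℝ) :
    fundamentalMatrix (reducedMatrix q μ) (x + T) *ᵥ v =
      fundamentalMatrix (reducedMatrix q μ) x *ᵥ (reducedMonodromy q T μ *ᵥ v) := by
  rw [fundamentalMatrix_add_period (continuous_reducedMatrix hq μ)
    (fun x => by simp [reducedMatrix, hper x]), Matrix.mulVec_mulVec, reducedMonodromy]

/-- The initial vectors with bounded first component form a subspace invariant under the monodromy.
If it is nonzero it contains an eigenvector, whose multiplier must be unimodular; no Jordan form is
needed. Conversely, an eigenvector with unimodular multiplier gives a solution of periodic modulus.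
-/
theorem exists_bounded_solution_iff (hq : Continuous q) {T : ℝ} (hT : 0 < T)
    (hper : Function.Periodic q T) (μ : ℂ) :
    (∃ v : Fin 3 → ℂ, v ≠ 0 ∧
      ∃ C, ∀ x, ‖(fundamentalMatrix (reducedMatrix q μ) x *ᵥ v) 0‖ ≤ C) ↔
    ∃ z : ℂ, ‖z‖ = 1 ∧ (reducedMonodromy q T μ).charpoly.IsRoot z := by
  have hroot : ∀ z, (reducedMonodromy q T μ).charpoly.IsRoot z ↔
      ∃ v : Fin 3 → ℂ, v ≠ 0 ∧ reducedMonodromy q T μ *ᵥ v = z • v := fun z => by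
    rw [← Matrix.charpoly_toLin', ← Module.End.hasEigenvalue_iff_isRoot_charpoly]
    constructor
    · intro h
      obtain ⟨v, hv⟩ := h.exists_hasEigenvector
      exact ⟨v, hv.2, by simpa using hv.apply_eq_smul⟩
    · rintro ⟨v, hv, h⟩
      exact Module.End.hasEigenvalue_of_hasEigenvector
        ⟨Module.End.mem_eigenspace_iff.mpr (by simpa using h), hv⟩
  have hfloq : ∀ (z : ℂ) (v : Fin 3 → ℂ), reducedMonodromy q T μ *ᵥ v = z • v → ∀ x,
      (fundamentalMatrix (reducedMatrix q μ) (x + T) *ᵥ v) 0 =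
        z * (fundamentalMatrix (reducedMatrix q μ) x *ᵥ v) 0 := fun z v h x => by
    rw [fundamentalMatrix_mulVec_add_period hq hper, h, Matrix.mulVec_smul, Pi.smul_apply,
      smul_eq_mul]
  constructor
  · rintro ⟨v, hv, C, hC⟩
    let V : Submodule ℂ (Fin 3 → ℂ) :=
      { carrier := {v | ∃ C, ∀ x, ‖(fundamentalMatrix (reducedMatrix q μ) x *ᵥ v) 0‖ ≤ C}
        add_mem' := by
          rintro a b ⟨C, hC⟩ ⟨D, hD⟩
          refine ⟨C + D, fun x => ?_⟩
          rw [Matrix.mulVec_add]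
          exact (norm_add_le _ _).trans (add_le_add (hC x) (hD x))
        zero_mem' := ⟨0, fun x => by simp⟩
        smul_mem' := by
          rintro z a ⟨C, hC⟩
          refine ⟨‖z‖ * C, fun x => ?_⟩
          rw [Matrix.mulVec_smul, Pi.smul_apply, norm_smul]
          exact mul_le_mul_of_nonneg_left (hC x) (norm_nonneg z) }
    have hmap : ∀ v ∈ V, (reducedMonodromy q T μ).toLin' v ∈ V := by
      rintro v ⟨C, hC⟩
      refine ⟨C, fun x => ?_⟩
      rw [Matrix.toLin'_apply, ← fundamentalMatrix_mulVec_add_period hq hper]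
      exact hC (x + T)
    have : Nontrivial V := ⟨⟨⟨v, C, hC⟩, 0, fun h => hv (congrArg Subtype.val h)⟩⟩
    obtain ⟨z, hz⟩ := Module.End.exists_eigenvalue ((reducedMonodromy q T μ).toLin'.restrict hmap)
    obtain ⟨⟨w, D, hD⟩, hw⟩ := hz.exists_hasEigenvector
    have hw0 : w ≠ 0 := fun h => hw.2 (Subtype.ext h)
    have hwz : reducedMonodromy q T μ *ᵥ w = z • w := by
      simpa using congrArg Subtype.val hw.apply_eq_smul
    have hz0 : z ≠ 0 := by
      rintro rfl
      have hdet : IsUnit (reducedMonodromy q T μ) := by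
        rw [Matrix.isUnit_iff_isUnit_det, det_reducedMonodromy hq]
        exact isUnit_one
      refine hw0 (Matrix.mulVec_injective_of_isUnit hdet ?_)
      simpa using hwz
    obtain ⟨x₀, hx₀⟩ := exists_ne_zero_of_initial_ne_zero hq μ hw0
    exact ⟨z, norm_multiplier_eq_one hz0 (hfloq z w hwz) hD hx₀, (hroot z).mpr ⟨w, hw0, hwz⟩⟩
  · rintro ⟨z, hz, hr⟩
    obtain ⟨v, hv, h⟩ := (hroot z).mp hr
    refine ⟨v, hv, ?_⟩
    have hp : Function.Periodic
        (fun x => ‖(fundamentalMatrix (reducedMatrix q μ) x *ᵥ v) 0‖) T := fun x => by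
      simp only [hfloq z v h, norm_mul, hz, one_mul]
    have hc : Continuous fun x => ‖(fundamentalMatrix (reducedMatrix q μ) x *ᵥ v) 0‖ :=
      (continuous_iff_continuousAt.mpr fun x => (hasDerivAt_fundamentalMatrix_mulVec
        (continuous_reducedMatrix hq μ) v x 0).continuousAt).norm
    obtain ⟨C, hC⟩ := (hp.isBounded_of_continuous hT.ne' hc).exists_norm_le
    exact ⟨C, fun x => by simpa using hC _ (mem_range_self x)⟩

end Floquet

end FloquetTheory

/-! ### From the standing wave to the reduced system -/

section StandingWaves

open Matrix

section StandingWave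

variable {f : ℝ → ℝ} {a c : ℝ} {u : ℝ → ℝ}

/-- The potential `q = c - f'(u)` of the operator `𝓛[u] = -∂ₓ² + q`. -/
def potential (f : ℝ → ℝ) (c : ℝ) (u : ℝ → ℝ) (x : ℝ) : ℝ := c - deriv f (u x)

theorem hasDerivAt_deriv_of_contDiff_two {g : ℝ → ℝ} (hg : ContDiff ℝ 2 g) (x : ℝ) :
    HasDerivAt (deriv g) (deriv (deriv g) x) x := by
  have h1 : ContDiff ℝ 1 (deriv g) := (contDiff_succ_iff_deriv.mp
    (show ContDiff ℝ (1 + 1) g by norm_num; exact hg)).2.2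
  exact (h1.differentiable one_ne_zero x).hasDerivAt

theorem contDiff_one_potential (hf : ContDiff ℝ 2 f) (hu : ContDiff ℝ 2 u) (c : ℝ) :
    ContDiff ℝ 1 (potential f c u) := by
  have h1 : ContDiff ℝ 1 (deriv f) := (contDiff_succ_iff_deriv.mp
    (show ContDiff ℝ (1 + 1) f by norm_num; exact hf)).2.2
  exact contDiff_const.sub (h1.comp (hu.of_le (by norm_num)))

theorem hasDerivAt_potential (hf : ContDiff ℝ 2 f) (hu : ContDiff ℝ 2 u) (c x : ℝ) :
    HasDerivAt (potential f c u) (-(deriv u x * deriv (deriv f) (u x))) x := by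
  have h1 := (hasDerivAt_deriv_of_contDiff_two hf (u x)).comp x
    (hu.differentiable (by norm_num) x).hasDerivAt
  exact (h1.const_sub c).congr_deriv (by ring)

/-- The change of variables from `(ψ, ψ', ψ'')` to `(ψ, ψ', 𝓛ψ)` and back. -/
def changeMatrix (q : ℝ → ℝ) (x : ℝ) : Matrix (Fin 3) (Fin 3) ℂ :=
  !![1, 0, 0; 0, 1, 0; (q x : ℂ), 0, -1]

theorem changeMatrix_mul_self (q : ℝ → ℝ) (x : ℝ) : changeMatrix q x * changeMatrix q x = 1 := by
  ext i j
  fin_cases i <;> fin_cases j <;>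
    simp [changeMatrix, Matrix.mul_apply, Fin.sum_univ_three]

theorem hasEntryDerivAt_changeMatrix {q : ℝ → ℝ} {q' x : ℝ} (hq : HasDerivAt q q' x) :
    HasEntryDerivAt (changeMatrix q) !![0, 0, 0; 0, 0, 0; (q' : ℂ), 0, 0] x := by
  intro i j
  fin_cases i <;> fin_cases j <;>
    first
    | exact hasDerivAt_const _ _
    | exact hq.ofReal_comp

/-- The change of variables carries one flow to the other. It takes equal values at `0` and `T` and
is its own inverse, so the two monodromy matrices are similar. -/
theorem monodromy_eq (hf : ContDiff ℝ 2 f) (hu : IsStandingWave f a c u) {T : ℝ}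
    (hper : Function.Periodic u T) (μ : ℂ) :
    monodromy f c u T μ = changeMatrix (potential f c u) 0 *
      reducedMonodromy (potential f c u) T μ * changeMatrix (potential f c u) 0 := by
  have hH := continuous_coeffMatrix hf hu μ
  have hq := hasDerivAt_potential hf hu.1 c
  set q := potential f c u with hqdef
  have hqc : Continuous q := (contDiff_one_potential hf hu.1 c).continuous
  have hs : ∀ x, HasEntryDerivAt
      (fun x => changeMatrix q x * fundamentalMatrix (coeffMatrix f c u μ) x)
      (reducedMatrix q μ x * (changeMatrix q x * fundamentalMatrix (coeffMatrix f c u μ) x)) x :=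
    fun x => by
      have h1 := (hasEntryDerivAt_changeMatrix (hq x)).mul
        (hasEntryDerivAt_fundamentalMatrix hH x)
      rw [← Matrix.mul_assoc, ← Matrix.add_mul] at h1
      rw [← Matrix.mul_assoc]
      convert h1 using 2
      ext i j
      fin_cases i <;> fin_cases j <;>
        simp [changeMatrix, reducedMatrix, coeffMatrix, Matrix.mul_apply, Fin.sum_univ_three,
          hqdef, potential]
  have h := eq_fundamentalMatrix_mul (continuous_reducedMatrix hqc μ) hs T
  have hqT : changeMatrix q T = changeMatrix q 0 := by
    have h0 : u T = u 0 := by simpa using hper 0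
    simp [changeMatrix, hqdef, potential, h0]
  rw [fundamentalMatrix_zero hH, Matrix.mul_one, hqT] at h
  rw [monodromy, reducedMonodromy, Matrix.mul_assoc, ← h, ← Matrix.mul_assoc,
    changeMatrix_mul_self, Matrix.one_mul]

theorem charpoly_monodromy (hf : ContDiff ℝ 2 f) (hu : IsStandingWave f a c u) {T : ℝ}
    (hper : Function.Periodic u T) (μ : ℂ) :
    (monodromy f c u T μ).charpoly = (reducedMonodromy (potential f c u) T μ).charpoly := by
  rw [monodromy_eq hf hu hper, Matrix.charpoly_mul_comm, ← Matrix.mul_assoc,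
    changeMatrix_mul_self, Matrix.one_mul]

theorem trace_monodromy (hf : ContDiff ℝ 2 f) (hu : IsStandingWave f a c u) {T : ℝ}
    (hper : Function.Periodic u T) (μ : ℂ) :
    (monodromy f c u T μ).trace = (reducedMonodromy (potential f c u) T μ).trace := by
  rw [monodromy_eq hf hu hper, Matrix.trace_mul_comm, ← Matrix.mul_assoc,
    changeMatrix_mul_self, Matrix.one_mul]

theorem differentiable_monodromy (hf : ContDiff ℝ 2 f) (hu : IsStandingWave f a c u) {T : ℝ}
    (hper : Function.Periodic u T) (i j : Fin 3) :
    Differentiable ℂ fun μ => monodromy f c u T μ i j := by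
  have := differentiable_reducedMonodromy (contDiff_one_potential hf hu.1 c).continuous T
  simp only [monodromy_eq hf hu hper, Matrix.mul_apply]
  fun_prop

theorem trDeriv_eq (hf : ContDiff ℝ 2 f) (hu : IsStandingWave f a c u) {T : ℝ}
    (hper : Function.Periodic u T) (k : ℕ) :
    trDeriv f c u T k =
      (iteratedDeriv k (fun μ => (reducedMonodromy (potential f c u) T μ).trace) 0).re := by
  have h := differentiable_monodromy hf hu hper
  simp only [← trace_monodromy hf hu hper]
  simp only [trDeriv, Matrix.trace, Matrix.diag_apply, Matrix.of_apply]
  rw [iteratedDeriv_fun_sum fun i _ => (h i i).contDiff.contDiffAt]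

theorem mem_spec_iff (hf : ContDiff ℝ 2 f) (hu : IsStandingWave f a c u) {T : ℝ} (hT : 0 < T)
    (hper : Function.Periodic u T) (μ : ℂ) :
    μ ∈ spec f c u ↔
      ∃ z : ℂ, ‖z‖ = 1 ∧ (reducedMonodromy (potential f c u) T μ).charpoly.IsRoot z := by
  have hq1 := contDiff_one_potential hf hu.1 c
  have hq := hasDerivAt_potential hf hu.1 c
  have hLψ : ∀ ψ : ℝ → ℂ, (fun x => -deriv (deriv ψ) x - ((deriv f (u x) : ℝ) : ℂ) * ψ x +
      (c : ℂ) * ψ x) = fun x => (potential f c u x : ℂ) * ψ x - deriv (deriv ψ) x := fun ψ => by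
    funext x
    simp only [potential]
    push_cast
    ring
  have hqper : Function.Periodic (potential f c u) T := fun x => by simp [potential, hper x]
  set q := potential f c u
  rw [← exists_bounded_solution_iff hq1.continuous hT hqper μ]
  have hA := continuous_reducedMatrix hq1.continuous μ
  constructor
  · rintro ⟨ψ, hψ, hne, ⟨C, hC⟩, heq⟩
    have hψ1 : ContDiff ℝ 2 (deriv ψ) := (contDiff_succ_iff_deriv.mp
      (show ContDiff ℝ (2 + 1) ψ by norm_num; exact hψ)).2.2
    have hψ2 : ContDiff ℝ 1 (deriv (deriv ψ)) := (contDiff_succ_iff_deriv.mp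
      (show ContDiff ℝ (1 + 1) (deriv ψ) by norm_num; exact hψ1)).2.2
    have hd0 := fun x => (hψ.differentiable (by norm_num) x).hasDerivAt
    have hd1 := fun x => (hψ1.differentiable (by norm_num) x).hasDerivAt
    have hd2 := fun x => (hψ2.differentiable (by norm_num) x).hasDerivAt
    let w : ℝ → Fin 3 → ℂ := fun x => ![ψ x, deriv ψ x, q x * ψ x - deriv (deriv ψ) x]
    have hw : ∀ x i, HasDerivAt (fun y => w y i) ((reducedMatrix q μ x *ᵥ w x) i) x := by
      intro x i
      rw [reducedMatrix_mulVec]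
      fin_cases i
      · exact hd0 x
      · exact (hd1 x).congr_deriv (by simp [w])
      · have h3 := ((hq x).ofReal_comp.mul (hd0 x)).sub (hd2 x)
        have h4 := heq x
        rw [linearizedOp, hLψ] at h4
        exact h3.congr_deriv (h3.deriv.symm.trans h4)
    have hsol := eq_fundamentalMatrix_mulVec hA hw
    refine ⟨w 0, fun h0 => hne (funext fun x => ?_), C, fun x => ?_⟩
    · have := congrFun (hsol x) 0
      rw [h0, Matrix.mulVec_zero] at this
      exact this
    · rw [← hsol x]
      exact hC x
  · rintro ⟨v, hv, C, hC⟩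
    obtain ⟨x₀, hx₀⟩ := exists_ne_zero_of_initial_ne_zero hq1.continuous μ hv
    have hd := hasDerivAt_fundamentalMatrix_mulVec hA v
    simp only [reducedMatrix_mulVec] at hd
    set w : Fin 3 → ℝ → ℂ := fun i x => (fundamentalMatrix (reducedMatrix q μ) x *ᵥ v) i
    have hd0 : ∀ x, HasDerivAt (w 0) (w 1 x) x := fun x => hd x 0
    have hd1 : ∀ x, HasDerivAt (w 1) (q x * w 0 x - w 2 x) x := fun x => hd x 1
    have hd2 : ∀ x, HasDerivAt (w 2) (μ * w 0 x) x := fun x => hd x 2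
    have e0 : deriv (w 0) = w 1 := funext fun x => (hd0 x).deriv
    have e1 : deriv (w 1) = fun x => q x * w 0 x - w 2 x := funext fun x => (hd1 x).deriv
    have e2 : deriv (w 2) = fun x => μ * w 0 x := funext fun x => (hd2 x).deriv
    have c0 : ContDiff ℝ 1 (w 0) := contDiff_one_iff_deriv.mpr
      ⟨fun x => (hd0 x).differentiableAt, by
        rw [e0]; exact continuous_iff_continuousAt.mpr fun x => (hd1 x).continuousAt⟩
    have c2 : ContDiff ℝ 1 (w 2) := contDiff_one_iff_deriv.mpr
      ⟨fun x => (hd2 x).differentiableAt, by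
        rw [e2]; exact continuous_const.mul c0.continuous⟩
    -- Regularity is gained step by step: `q` is only `C¹`, but this makes `ψ'` of class `C²` and
    -- hence `ψ` of class `C³`.
    have c1 : ContDiff ℝ (1 + 1) (w 1) := by
      rw [contDiff_succ_iff_deriv]
      refine ⟨fun x => (hd1 x).differentiableAt, by simp, ?_⟩
      rw [e1]
      exact ((ofRealCLM.contDiff.comp hq1).mul c0).sub c2
    have c3 : ContDiff ℝ (2 + 1) (w 0) := by
      rw [contDiff_succ_iff_deriv]
      refine ⟨fun x => (hd0 x).differentiableAt, by simp, ?_⟩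
      rw [e0]
      exact c1.of_le (by norm_num)
    refine ⟨w 0, c3.of_le (by norm_num), fun h => hx₀ (congrFun h x₀), ⟨C, hC⟩, fun x => ?_⟩
    rw [linearizedOp, hLψ, e0, e1]
    simp only [sub_sub_cancel]
    exact (hd2 x).deriv

/-- Differentiating the profile equation shows that `p = u'` solves `p'' = q p`. Its mean is zero
because `u` is periodic, and its initial data are nonzero, since otherwise `u'` would vanish
identically. -/
theorem trace_reducedMonodromy_potential (hf : ContDiff ℝ 2 f) (hu : IsStandingWave f a c u)
    (hnc : ¬ ∃ k : ℝ, ∀ x, u x = k) {T : ℝ} (hper : Function.Periodic u T) :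
    (reducedMonodromy (potential f c u) T 0).trace = 3 ∧
      HasDerivAt (fun μ => (reducedMonodromy (potential f c u) T μ).trace) 0 0 := by
  have hq : Continuous (potential f c u) := (contDiff_one_potential hf hu.1 c).continuous
  have hu1 : ∀ x, HasDerivAt u (deriv u x) x := fun x =>
    (hu.1.differentiable (by norm_num) x).hasDerivAt
  have hu2 := hasDerivAt_deriv_of_contDiff_two hu.1
  have hu2eq : deriv (deriv u) = fun x => a - f (u x) + c * u x := by
    funext x
    linarith [hu.2 x]
  have hu3 : ∀ x, HasDerivAt (deriv (deriv u)) (potential f c u x * deriv u x) x := fun x => by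
    rw [hu2eq]
    have h1 := ((hf.differentiable (by norm_num) (u x)).hasDerivAt.comp x (hu1 x))
    refine ((h1.const_sub a).add ((hu1 x).const_mul c)).congr_deriv ?_
    simp only [potential]
    ring
  have hper1 : Function.Periodic (deriv u) T := fun x => by
    have h := (hu1 (x + T)).comp_add_const x T
    rw [show (fun x => u (x + T)) = u from funext hper] at h
    exact h.unique (hu1 x)
  refine trace_reducedMonodromy_expansion hq hu2 hu3 (by simpa using hper1 0) ?_ ?_ ?_
  · simp only [hu2eq]
    rw [show u T = u 0 by simpa using hper 0]
  · rw [intervalIntegral.integral_eq_sub_of_hasDerivAt (fun x _ => hu1 x)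
      ((hu.1.continuous_deriv (by norm_num)).intervalIntegrable _ _),
      show u T = u 0 by simpa using hper 0, sub_self]
  · by_contra! h
    refine hnc ⟨u 0, fun x => is_const_of_deriv_eq_zero (fun x => (hu1 x).differentiableAt)
      (fun x => ?_) x 0⟩
    have := (fundamentalMatrix_reducedMatrix_zero_mulVec hq hu2 hu3 x).1
    simpa [h.1, h.2] using this

end StandingWave

end StandingWaves

/-! ### Roots of the limiting cubic -/

section CubicEquation

section RealCubic

theorem exists_real_root (b₂ b₃ : ℝ) : ∃ s : ℝ, 4 * s ^ 3 - b₂ * s - b₃ = 0 := by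
  set M : ℝ := |b₂| + |b₃| + 1 with hM
  have h2 := abs_nonneg b₂
  have h3 := abs_nonneg b₃
  have hM1 : 1 ≤ M := by linarith
  have hM2 : M ≤ M ^ 2 := by nlinarith
  have hM3 : M ^ 2 ≤ M ^ 3 := by nlinarith
  have hb2 : |b₂| * M + |b₃| ≤ M ^ 2 := by nlinarith
  have e2 : b₂ * M ≤ |b₂| * M := mul_le_mul_of_nonneg_right (le_abs_self _) (by linarith)
  have e2' : -b₂ * M ≤ |b₂| * M := mul_le_mul_of_nonneg_right (neg_le_abs _) (by linarith)
  have hmem : (0 : ℝ) ∈ Icc (4 * (-M) ^ 3 - b₂ * (-M) - b₃) (4 * M ^ 3 - b₂ * M - b₃) :=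
    ⟨by nlinarith [neg_le_abs b₃], by nlinarith [le_abs_self b₃]⟩
  obtain ⟨s, -, hs⟩ := intermediate_value_Icc (show -M ≤ M by linarith)
    (f := fun s => 4 * s ^ 3 - b₂ * s - b₃) (by fun_prop) hmem
  exact ⟨s, hs⟩

/-- A depressed cubic with positive discriminant has three simple real roots. -/
theorem exists_three_real_roots {b₂ b₃ : ℝ} (h : 0 < 4 * b₂ ^ 3 - 108 * b₃ ^ 2) :
    ∃ s₁ s₂ s₃ : ℝ, s₁ ≠ s₂ ∧ s₁ ≠ s₃ ∧ s₂ ≠ s₃ ∧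
      ∀ x : ℂ, 4 * x ^ 3 - b₂ * x - b₃ = 4 * (x - s₁) * (x - s₂) * (x - s₃) := by
  obtain ⟨s, hs⟩ := exists_real_root b₂ b₃
  have hb3 : b₃ = 4 * s ^ 3 - b₂ * s := by linarith
  -- After dividing by `x - s`, the quadratic `4x² + 4sx + 4s² - b₂` remains. Its discriminant is
  -- `16(b₂ - 3s²)`, and its value at `s` is `12s² - b₂`.
  have hfac : 4 * b₂ ^ 3 - 108 * b₃ ^ 2 = 4 * (b₂ - 3 * s ^ 2) * (b₂ - 12 * s ^ 2) ^ 2 := by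
    rw [hb3]; ring
  rw [hfac] at h
  have h1 : b₂ - 12 * s ^ 2 ≠ 0 := fun h0 => by simp [h0] at h
  have hd : 0 < b₂ - 3 * s ^ 2 := by
    have := pos_of_mul_pos_left h (sq_nonneg _)
    linarith
  obtain ⟨d, hd0, hdd⟩ : ∃ d : ℝ, 0 < d ∧ d ^ 2 = b₂ - 3 * s ^ 2 :=
    ⟨√(b₂ - 3 * s ^ 2), Real.sqrt_pos.mpr hd, Real.sq_sqrt hd.le⟩
  have hb2 : b₂ = d ^ 2 + 3 * s ^ 2 := by linarith
  refine ⟨s, (-s + d) / 2, (-s - d) / 2, fun h => h1 ?_, fun h => h1 ?_, fun h => ?_, fun x => ?_⟩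
  · have : d = 3 * s := by linarith
    rw [hb2, this]; ring
  · have : d = -3 * s := by linarith
    rw [hb2, this]; ring
  · linarith
  · rw [hb3, hb2]
    push_cast
    ring

/-- A depressed cubic with negative discriminant has one real root and two conjugate ones. -/
theorem exists_conj_roots {b₂ b₃ : ℝ} (h : 4 * b₂ ^ 3 - 108 * b₃ ^ 2 < 0) (hb : b₃ ≠ 0) :
    ∃ (s₁ : ℝ) (s₂ : ℂ), s₁ ≠ 0 ∧ s₂.re ≠ 0 ∧ s₂.im ≠ 0 ∧
      ∀ x : ℂ, 4 * x ^ 3 - b₂ * x - b₃ = 4 * (x - s₁) * (x - s₂) * (x - conj s₂) := by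
  obtain ⟨s, hs⟩ := exists_real_root b₂ b₃
  have hb3 : b₃ = 4 * s ^ 3 - b₂ * s := by linarith
  have hfac : 4 * b₂ ^ 3 - 108 * b₃ ^ 2 = 4 * (b₂ - 3 * s ^ 2) * (b₂ - 12 * s ^ 2) ^ 2 := by
    rw [hb3]; ring
  rw [hfac] at h
  have hd : 0 < 3 * s ^ 2 - b₂ := by
    by_contra! h0
    have : 0 ≤ 4 * (b₂ - 3 * s ^ 2) * (b₂ - 12 * s ^ 2) ^ 2 :=
      mul_nonneg (by linarith) (sq_nonneg _)
    linarith
  have hs0 : s ≠ 0 := fun h0 => hb (by rw [hb3, h0]; ring)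
  obtain ⟨d, hd0, hdd⟩ : ∃ d : ℝ, 0 < d ∧ d ^ 2 = 3 * s ^ 2 - b₂ :=
    ⟨√(3 * s ^ 2 - b₂), Real.sqrt_pos.mpr hd, Real.sq_sqrt hd.le⟩
  have hb2 : b₂ = 3 * s ^ 2 - d ^ 2 := by linarith
  refine ⟨s, ⟨-s / 2, d / 2⟩, hs0, by simpa using hs0, by simpa using hd0.ne', fun x => ?_⟩
  have e1 : (⟨-s / 2, d / 2⟩ : ℂ) = -s / 2 + d / 2 * I := by
    apply Complex.ext <;> simp
  have e2 : conj (⟨-s / 2, d / 2⟩ : ℂ) = -s / 2 - d / 2 * I := by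
    apply Complex.ext <;> simp
  rw [e2, e1, hb3, hb2]
  push_cast
  linear_combination ((x - s) * d ^ 2) * I_sq

end RealCubic

/-! ### The Cayley transform of the multipliers -/

section Cayley

/-- The Cayley transform, which takes the real line to the unit circle. -/
def cayley (τ : ℂ) : ℂ := (1 + I * τ) / (1 - I * τ)

theorem one_sub_I_mul_ne_zero {τ : ℂ} (h : ‖τ‖ < 1) : 1 - I * τ ≠ 0 := fun h0 => by
  have : ‖I * τ‖ = 1 := by rw [← sub_eq_zero.mp h0, norm_one]
  rw [norm_mul, norm_I, one_mul] at this
  exact h.ne this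

/-- The squared moduli of numerator and denominator differ by `-4 Im τ`; the bound on `τ` excludes
the pole `-i`. -/
theorem norm_cayley_eq_one_iff {τ : ℂ} (h : ‖τ‖ < 1) : ‖cayley τ‖ = 1 ↔ τ.im = 0 := by
  rw [cayley, norm_div, div_eq_one_iff_eq (norm_ne_zero_iff.mpr (one_sub_I_mul_ne_zero h)),
    ← sq_eq_sq₀ (norm_nonneg _) (norm_nonneg _), Complex.sq_norm, Complex.sq_norm,
    Complex.normSq_apply, Complex.normSq_apply]
  simp only [add_re, sub_re, add_im, sub_im, mul_re, mul_im, I_re, I_im, one_re, one_im]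
  constructor
  · intro h; linarith
  · intro h; rw [h]; ring

theorem cayley_injOn : InjOn cayley (ball 0 1) := by
  intro s hs t ht h
  rw [mem_ball_zero_iff] at hs ht
  rw [cayley, cayley, div_eq_div_iff (one_sub_I_mul_ne_zero hs) (one_sub_I_mul_ne_zero ht)] at h
  exact mul_left_cancel₀ (mul_ne_zero two_ne_zero I_ne_zero) (by linear_combination h)

theorem roots_charpoly_eq_of_three {M : Matrix (Fin 3) (Fin 3) ℂ} {z₁ z₂ z₃ : ℂ}
    (h₁ : M.charpoly.eval z₁ = 0) (h₂ : M.charpoly.eval z₂ = 0) (h₃ : M.charpoly.eval z₃ = 0)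
    (h₁₂ : z₁ ≠ z₂) (h₁₃ : z₁ ≠ z₃) (h₂₃ : z₂ ≠ z₃) :
    M.charpoly.roots = {z₁, z₂, z₃} := by
  have h0 := M.charpoly_monic.ne_zero
  symm
  refine Multiset.eq_of_le_of_card_le ?_ ?_
  · rw [Multiset.le_iff_subset (by simp [h₁₂, h₁₃, h₂₃])]
    intro z hz
    simp only [Multiset.insert_eq_cons, Multiset.mem_cons, Multiset.mem_singleton] at hz
    rw [Polynomial.mem_roots h0]
    rcases hz with rfl | rfl | rfl <;> assumption
  · refine (Polynomial.card_roots' _).trans ?_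
    rw [Matrix.charpoly_natDegree_eq_dim]
    simp

theorem roots_charpoly_eq_of_eval {M : Matrix (Fin 3) (Fin 3) ℂ}
    (h : ∀ z, M.charpoly.eval z = (z - 1) ^ 3) : M.charpoly.roots = {1, 1, 1} := by
  have : M.charpoly = (Polynomial.X - Polynomial.C 1) ^ 3 :=
    Polynomial.funext fun z => by simp [h z]
  rw [this, Polynomial.roots_pow, Polynomial.roots_X_sub_C]
  rfl

end Cayley

/-! ### Desingularization of the characteristic equation -/

section Scaling

/-- The characteristic equation at `μ = iη`, `λ = cayley (ησ)`, after division by `η³`. -/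
def scaledCubic (E O : ℂ → ℂ) (p : ℂ × ℂ) : ℂ :=
  4 * p.2 ^ 3 - (1 + p.2 ^ 2 * p.1 ^ 2) * (p.2 * E p.1 + O p.1)

theorem iteratedDeriv_conj {a : ℂ → ℂ} (ha : Differentiable ℂ a)
    (hconj : ∀ μ, a (conj μ) = conj (a μ)) (k : ℕ) (μ : ℂ) :
    iteratedDeriv k a (conj μ) = conj (iteratedDeriv k a μ) := by
  induction k generalizing μ with
  | zero => simpa using hconj μ
  | succ k ih =>
    rw [iteratedDeriv_succ]
    have hd : HasDerivAt (iteratedDeriv k a) (deriv (iteratedDeriv k a) μ) μ :=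
      ((ha.contDiff (n := ⊤)).differentiable_iteratedDeriv k (by simp) μ).hasDerivAt
    have h1 := hd.conj_conj
    have h2 : conj ∘ iteratedDeriv k a ∘ conj = iteratedDeriv k a := by
      funext z
      simp [ih]
    rw [h2] at h1
    exact h1.deriv

/-- In `a(iη) = 3 - η² E(η) - iη³ O(η)` the functions `E` and `O` come from the even and odd parts
in `η`. Because `a(0) = 3` and `a'(0) = 0`, these parts, after removal of the constant, are
divisible by `η²` and `η³`. The term `(z - 1)³` contributes `-8iη³σ³` to the cleared equation, so
`η³` factors out of the whole. -/
theorem exists_scaledCubic {a : ℂ → ℂ} (ha : Differentiable ℂ a)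
    (hconj : ∀ μ, a (conj μ) = conj (a μ)) (h0 : a 0 = 3) (h1 : HasDerivAt a 0 0) :
    ∃ E O : ℂ → ℂ, AnalyticAt ℂ E 0 ∧ AnalyticAt ℂ O 0 ∧
      E 0 = ((iteratedDeriv 2 a 0).re / 2 : ℝ) ∧ O 0 = ((iteratedDeriv 3 a 0).re / 6 : ℝ) ∧
      (∀ η, E (conj η) = conj (E η)) ∧ (∀ η, O (conj η) = conj (O η)) ∧
      ∀ η σ, 1 - I * (η * σ) ≠ 0 →
        (1 - I * (η * σ)) ^ 3 * (cayley (η * σ) ^ 3 - a (I * η) * cayley (η * σ) ^ 2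
          + a (-(I * η)) * cayley (η * σ) - 1) = -2 * I * η ^ 3 * scaledCubic E O (η, σ) := by
  obtain ⟨C, hC, hT⟩ := (ha.analyticAt 0).exists_eq_sum_add_pow_mul 4
  have hre : ∀ k, iteratedDeriv k a 0 = ((iteratedDeriv k a 0).re : ℂ) := fun k => by
    have := iteratedDeriv_conj ha hconj k 0
    rw [map_zero] at this
    exact (Complex.conj_eq_iff_re.mp this.symm).symm
  set t₂ := (iteratedDeriv 2 a 0).re
  set t₃ := (iteratedDeriv 3 a 0).re
  have h2 : iteratedDeriv 2 a 0 = t₂ := hre 2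
  have h3 : iteratedDeriv 3 a 0 = t₃ := hre 3
  have hexp : ∀ μ, a μ = 3 + t₂ / 2 * μ ^ 2 + t₃ / 6 * μ ^ 3 + μ ^ 4 * C μ := fun μ => by
    rw [hT μ]
    simp only [Finset.sum_range_succ, Finset.sum_range_zero, iteratedDeriv_zero, h0,
      iteratedDeriv_one, h1.deriv, h2, h3, smul_eq_mul]
    norm_num [Nat.factorial]
    ring
  -- Writing the quotients through the Taylor remainder `C` makes them analytic at `0` with no
  -- removable singularity to treat.
  let E : ℂ → ℂ := fun η => t₂ / 2 - η ^ 2 * (C (I * η) + C (-(I * η))) / 2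
  let O : ℂ → ℂ := fun η => t₃ / 6 + I * η * (C (I * η) - C (-(I * η))) / 2
  have hE : ∀ η, -2 * η ^ 2 * E η = a (I * η) + a (-(I * η)) - 6 := fun η => by
    rw [hexp, hexp]
    simp only [E]
    linear_combination (-t₂ * η ^ 2 - (I ^ 2 - 1) * η ^ 4 * (C (I * η) + C (-(I * η)))) * I_sq
  have hO : ∀ η, -2 * I * η ^ 3 * O η = a (I * η) - a (-(I * η)) := fun η => by
    rw [hexp, hexp]
    simp only [O]
    linear_combination (-t₃ / 3 * I * η ^ 3 - I ^ 2 * η ^ 4 * (C (I * η) - C (-(I * η)))) * I_sq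
  have c1 : ∀ η, a (I * conj η) = conj (a (-(I * η))) := fun η => by
    rw [← hconj]; simp
  have c2 : ∀ η, a (-(I * conj η)) = conj (a (I * η)) := fun η => by
    rw [← hconj]; simp
  have hCI : AnalyticAt ℂ (fun η => C (I * η)) 0 :=
    AnalyticAt.fun_comp (g := C) (by simpa using hC) (by fun_prop)
  have hCI' : AnalyticAt ℂ (fun η => C (-(I * η))) 0 :=
    AnalyticAt.fun_comp (g := C) (by simpa using hC) (by fun_prop)
  have hE0 : E 0 = (t₂ / 2 : ℝ) := by simp [E]
  have hO0 : O 0 = (t₃ / 6 : ℝ) := by simp [O]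
  refine ⟨E, O, ?_, ?_, hE0, hO0, fun η => ?_, fun η => ?_, fun η σ hne => ?_⟩
  · exact analyticAt_const.sub (((by fun_prop : AnalyticAt ℂ (fun η : ℂ => η ^ 2) 0).mul
      (hCI.add hCI')).div analyticAt_const two_ne_zero)
  · exact analyticAt_const.add (((by fun_prop : AnalyticAt ℂ (fun η : ℂ => I * η) 0).mul
      (hCI.sub hCI')).div analyticAt_const two_ne_zero)
  -- Away from `0` the symmetry follows by cancelling `η²` in `hE`; at `0` the value is real.
  · by_cases h : η = 0
    · rw [h, map_zero, hE0, Complex.conj_ofReal]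
    · have h2 : conj η ≠ 0 := by simpa using h
      have e1 := hE (conj η)
      have e2 := congrArg conj (hE η)
      simp only [map_mul, map_sub, map_add, map_pow, map_neg, map_ofNat] at e2
      rw [c1, c2] at e1
      refine mul_left_cancel₀ (mul_ne_zero (by norm_num : (-2 : ℂ) ≠ 0) (pow_ne_zero 2 h2)) ?_
      rw [e1, e2]
      ring
  · by_cases h : η = 0
    · rw [h, map_zero, hO0, Complex.conj_ofReal]
    · have h2 : conj η ≠ 0 := by simpa using h
      have e1 := hO (conj η)
      have e2 := congrArg conj (hO η)
      simp only [map_mul, map_sub, map_pow, map_neg, map_ofNat, conj_I] at e2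
      rw [c1, c2] at e1
      refine mul_left_cancel₀ (mul_ne_zero (mul_ne_zero (by norm_num : (-2 : ℂ) ≠ 0) I_ne_zero)
        (pow_ne_zero 3 h2)) ?_
      rw [e1]
      linear_combination e2
  · have hc : cayley (η * σ) * (1 - I * (η * σ)) = 1 + I * (η * σ) := div_mul_cancel₀ _ hne
    simp only [scaledCubic]
    have e1 : a (I * η) = 3 - η ^ 2 * E η - I * η ^ 3 * O η := by
      linear_combination (-1 / 2) * hE η - 1 / 2 * hO η
    have e2 : a (-(I * η)) = 3 - η ^ 2 * E η + I * η ^ 3 * O η := by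
      linear_combination (-1 / 2) * hE η + 1 / 2 * hO η
    rw [e1, e2]
    have expand : ∀ z w A B : ℂ, w ^ 3 * (z ^ 3 - A * z ^ 2 + B * z - 1) =
        (z * w) ^ 3 - A * (z * w) ^ 2 * w + B * (z * w) * w ^ 2 - w ^ 3 := fun z w A B => by ring
    rw [expand, hc]
    have hI3 : I ^ 3 = -I := by rw [pow_succ, I_sq]; ring
    ring_nf
    simp only [hI3]
    ring

end Scaling

end CubicEquation

/-! ### Analytic branches of multipliers near the origin -/

section LocalBranches

open Filter Topology

section Branch

/-- `φ` is the local branch through `(0, s)` of the zero set of the scaled cubic. -/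
structure IsBranch (E O : ℂ → ℂ) (s : ℂ) (φ : ℂ → ℂ) : Prop where
  contDiffAt : ContDiffAt ℂ ω φ 0
  apply_zero : φ 0 = s
  eventually_iff : ∀ᶠ p : ℂ × ℂ in 𝓝 (0, s), scaledCubic E O p = 0 ↔ φ p.1 = p.2

variable {E O : ℂ → ℂ}

/-- This is the implicit function theorem: the derivative in `σ` at `(0, s)` is `12s² - E(0)`,
nonzero when `s` is a simple root. -/
theorem exists_isBranch (hE : AnalyticAt ℂ E 0) (hO : AnalyticAt ℂ O 0) {s : ℂ}
    (hs : 4 * s ^ 3 - E 0 * s - O 0 = 0) (hs' : 12 * s ^ 2 - E 0 ≠ 0) :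
    ∃ φ, IsBranch E O s φ := by
  have hE' : AnalyticAt ℂ (fun p : ℂ × ℂ => E p.1) (0, s) :=
    AnalyticAt.fun_comp (g := E) hE analyticAt_fst
  have hO' : AnalyticAt ℂ (fun p : ℂ × ℂ => O p.1) (0, s) :=
    AnalyticAt.fun_comp (g := O) hO analyticAt_fst
  have hF : AnalyticAt ℂ (scaledCubic E O) (0, s) :=
    (analyticAt_const.mul (analyticAt_snd.pow 3)).sub
      ((analyticAt_const.add ((analyticAt_snd.pow 2).mul (analyticAt_fst.pow 2))).mul
        ((analyticAt_snd.mul hE').add hO'))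
  have hF0 : scaledCubic E O (0, s) = 0 := by
    simp only [scaledCubic]
    linear_combination hs
  have hcd : ContDiffAt ℂ ω (scaledCubic E O) (0, s) := hF.contDiffAt
  have hinv : (fderiv ℂ (scaledCubic E O) (0, s) ∘L .inr ℂ ℂ ℂ).IsInvertible := by
    refine ⟨ContinuousLinearEquiv.unitsEquivAut ℂ (Units.mk0 _ hs'), ?_⟩
    ext
    have h1 : HasDerivAt (fun σ : ℂ => ((0 : ℂ), σ)) (0, 1) s :=
      (hasDerivAt_const s (0 : ℂ)).prodMk (hasDerivAt_id s)
    have h2 := hF.differentiableAt.hasFDerivAt.comp_hasDerivAt s h1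
    have h3 : HasDerivAt (fun σ : ℂ => 4 * σ ^ 3 - (σ * E 0 + O 0)) (12 * s ^ 2 - E 0) s := by
      have := ((hasDerivAt_pow 3 s).const_mul 4).sub
        (((hasDerivAt_id s).mul_const (E 0)).add_const (O 0))
      refine this.congr_deriv ?_
      push_cast
      ring
    have h4 : (scaledCubic E O ∘ fun σ : ℂ => ((0 : ℂ), σ)) =
        fun σ : ℂ => 4 * σ ^ 3 - (σ * E 0 + O 0) := by
      funext σ
      simp [scaledCubic]
    rw [h4] at h2
    simpa using h3.unique h2
  refine ⟨hcd.implicitFunction (by simp) hinv, hcd.contDiffAt_implicitFunction (by simp) hinv,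
    hcd.implicitFunction_apply_self (by simp) hinv, ?_⟩
  have := hcd.eventually_apply_eq_iff_implicitFunction (by simp) hinv
  rwa [hF0] at this

namespace IsBranch

variable {s : ℂ} {φ φ' : ℂ → ℂ}

theorem tendsto (h : IsBranch E O s φ) : Tendsto φ (𝓝 0) (𝓝 s) := by
  have := h.contDiffAt.continuousAt.tendsto
  rwa [h.apply_zero] at this

theorem eventually_eq_zero (h : IsBranch E O s φ) :
    ∀ᶠ η in 𝓝 (0 : ℂ), scaledCubic E O (η, φ η) = 0 := by
  have h1 : Tendsto (fun η : ℂ => (η, φ η)) (𝓝 0) (𝓝 (0, s)) := tendsto_id.prodMk_nhds h.tendsto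
  filter_upwards [h1.eventually h.eventually_iff] with η hη
  exact hη.mpr rfl

/-- The conjugate of a zero of the scaled cubic is again a zero, and local uniqueness places it on
the branch through `conj s`. -/
theorem eventually_conj (hE : ∀ η, E (conj η) = conj (E η)) (hO : ∀ η, O (conj η) = conj (O η))
    (h : IsBranch E O s φ) (h' : IsBranch E O (conj s) φ') :
    ∀ᶠ η in 𝓝 (0 : ℂ), φ' (conj η) = conj (φ η) := by
  have hc : Tendsto (fun η : ℂ => conj η) (𝓝 0) (𝓝 0) := by
    simpa using (Complex.continuous_conj.tendsto (0 : ℂ))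
  have h1 : Tendsto (fun η : ℂ => (conj η, conj (φ η))) (𝓝 0) (𝓝 (0, conj s)) :=
    hc.prodMk_nhds ((Complex.continuous_conj.tendsto s).comp h.tendsto)
  filter_upwards [h1.eventually h'.eventually_iff, h.eventually_eq_zero] with η hη h0
  refine hη.mp ?_
  have := congrArg conj h0
  simp only [scaledCubic, map_sub, map_mul, map_add, map_pow, map_ofNat, map_one, map_zero] at this
  simp only [scaledCubic, hE, hO]
  exact this

theorem hasStrictDerivAt (h : IsBranch E O s φ) : HasStrictDerivAt (fun η => η * φ η) s 0 := by
  have h1 := (hasStrictDerivAt_id (0 : ℂ)).mul (h.contDiffAt.hasStrictDerivAt (by simp))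
  exact h1.congr_deriv (by simp [h.apply_zero])

theorem tendsto_mul (h : IsBranch E O s φ) : Tendsto (fun η => η * φ η) (𝓝 0) (𝓝 0) := by
  simpa using tendsto_id.mul h.tendsto

theorem exists_inverse (h : IsBranch E O s φ) (hs : s ≠ 0) :
    ∃ g : ℂ → ℂ, ContDiffAt ℂ ω g 0 ∧ g 0 = 0 ∧ HasDerivAt g s⁻¹ 0 ∧
      (∀ᶠ η in 𝓝 (0 : ℂ), g (η * φ η) = η) ∧ ∀ᶠ x in 𝓝 (0 : ℂ), g x * φ (g x) = x := by
  have hcd : ContDiffAt ℂ ω (fun η => η * φ η) 0 := contDiffAt_id.mul h.contDiffAt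
  have hd := h.hasStrictDerivAt
  have h0 : (0 : ℂ) * φ 0 = 0 := zero_mul _
  have hf' := hd.hasStrictFDerivAt_equiv hs
  have hg := hcd.to_localInverse hf'.hasFDerivAt (by simp)
  have hl := hf'.eventually_left_inverse
  have hr := hf'.eventually_right_inverse
  have hg' := hd.to_localInverse hs
  simp only [h0] at hg hr hg'
  exact ⟨hf'.localInverse, hg, by simpa [h0] using hl.self_of_nhds, hg'.hasDerivAt, hl, hr⟩

/-- For real `s` the map `η ↦ ηφ(η)` commutes with conjugation, and it is locally injective because
its derivative at `0` is `s`. -/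
theorem eventually_im_eq_zero_iff (hE : ∀ η, E (conj η) = conj (E η))
    (hO : ∀ η, O (conj η) = conj (O η)) {s : ℝ} (h : IsBranch E O s φ) (hs : s ≠ 0) :
    ∀ᶠ η in 𝓝 (0 : ℂ), (η * φ η).im = 0 ↔ η.im = 0 := by
  obtain ⟨g, -, -, -, hg, -⟩ := h.exists_inverse (Complex.ofReal_ne_zero.mpr hs)
  have hc : Tendsto (fun η : ℂ => conj η) (𝓝 0) (𝓝 0) := by
    simpa using (Complex.continuous_conj.tendsto (0 : ℂ))
  have h' : IsBranch E O (conj (s : ℂ)) φ := by rwa [Complex.conj_ofReal]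
  filter_upwards [hg, hc.eventually hg, eventually_conj hE hO h h'] with η h1 h2 h3
  have h4 : conj η * φ (conj η) = conj (η * φ η) := by rw [h3, map_mul]
  rw [← Complex.conj_eq_iff_im, ← Complex.conj_eq_iff_im, ← h4]
  constructor
  · intro h5
    rw [← h2, h5, h1]
  · intro h5
    rw [h5]

end IsBranch

theorem eventually_roots_charpoly {N : ℂ → Matrix (Fin 3) (Fin 3) ℂ}
    (hN : ∀ η σ, 1 - I * (η * σ) ≠ 0 → (1 - I * (η * σ)) ^ 3 *
      (N (I * η)).charpoly.eval (cayley (η * σ)) = -2 * I * η ^ 3 * scaledCubic E O (η, σ))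
    (hN0 : ∀ z, (N 0).charpoly.eval z = (z - 1) ^ 3) {s₁ s₂ s₃ : ℂ} {φ₁ φ₂ φ₃ : ℂ → ℂ}
    (h₁ : IsBranch E O s₁ φ₁) (h₂ : IsBranch E O s₂ φ₂) (h₃ : IsBranch E O s₃ φ₃)
    (h₁₂ : s₁ ≠ s₂) (h₁₃ : s₁ ≠ s₃) (h₂₃ : s₂ ≠ s₃) :
    ∀ᶠ η in 𝓝 (0 : ℂ), (N (I * η)).charpoly.roots =
        {cayley (η * φ₁ η), cayley (η * φ₂ η), cayley (η * φ₃ η)} ∧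
      ‖η * φ₁ η‖ < 1 ∧ ‖η * φ₂ η‖ < 1 ∧ ‖η * φ₃ η‖ < 1 := by
  have hsmall : ∀ {s φ}, IsBranch E O s φ → ∀ᶠ η in 𝓝 (0 : ℂ), ‖η * φ η‖ < 1 := fun h => by
    have := h.tendsto_mul.norm.eventually_lt_const (show ‖(0 : ℂ)‖ < 1 by simp)
    exact this
  have hdist : ∀ {s s' φ φ'}, IsBranch E O s φ → IsBranch E O s' φ' → s ≠ s' →
      ∀ᶠ η in 𝓝 (0 : ℂ), φ η ≠ φ' η := fun h h' hne =>
    ((h.tendsto.sub h'.tendsto).eventually_ne (sub_ne_zero.mpr hne)).mono fun _ => sub_ne_zero.mp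
  filter_upwards [hsmall h₁, hsmall h₂, hsmall h₃, hdist h₁ h₂ h₁₂, hdist h₁ h₃ h₁₃,
    hdist h₂ h₃ h₂₃, h₁.eventually_eq_zero, h₂.eventually_eq_zero, h₃.eventually_eq_zero]
    with η n₁ n₂ n₃ d₁₂ d₁₃ d₂₃ z₁ z₂ z₃
  refine ⟨?_, n₁, n₂, n₃⟩
  -- At `η = 0` the three multipliers coincide at 1. Otherwise distinct branches give distinct
  -- multipliers, which exhaust a cubic.
  by_cases hη : η = 0
  · subst hη
    rw [mul_zero, roots_charpoly_eq_of_eval hN0]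
    simp [cayley]
  · have hz : ∀ σ, ‖η * σ‖ < 1 → scaledCubic E O (η, σ) = 0 →
        (N (I * η)).charpoly.eval (cayley (η * σ)) = 0 := fun σ hn hz => by
      have hne := one_sub_I_mul_ne_zero hn
      have := hN η σ hne
      rw [hz, mul_zero] at this
      exact (mul_eq_zero.mp this).resolve_left (pow_ne_zero 3 hne)
    have hd : ∀ σ σ', ‖η * σ‖ < 1 → ‖η * σ'‖ < 1 → σ ≠ σ' →
        cayley (η * σ) ≠ cayley (η * σ') := fun σ σ' hn hn' hne h =>
      hne (mul_left_cancel₀ hη (cayley_injOn (by simpa using hn) (by simpa using hn') h))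
    exact roots_charpoly_eq_of_three (hz _ n₁ z₁) (hz _ n₂ z₂) (hz _ n₃ z₃)
      (hd _ _ n₁ n₂ d₁₂) (hd _ _ n₁ n₃ d₁₃) (hd _ _ n₂ n₃ d₂₃)

open Classical in
theorem eventually_unit_roots {N : ℂ → Matrix (Fin 3) (Fin 3) ℂ}
    (hN : ∀ η σ, 1 - I * (η * σ) ≠ 0 → (1 - I * (η * σ)) ^ 3 *
      (N (I * η)).charpoly.eval (cayley (η * σ)) = -2 * I * η ^ 3 * scaledCubic E O (η, σ))
    (hN0 : ∀ z, (N 0).charpoly.eval z = (z - 1) ^ 3) {s₁ s₂ s₃ : ℂ} {φ₁ φ₂ φ₃ : ℂ → ℂ}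
    (h₁ : IsBranch E O s₁ φ₁) (h₂ : IsBranch E O s₂ φ₂) (h₃ : IsBranch E O s₃ φ₃)
    (h₁₂ : s₁ ≠ s₂) (h₁₃ : s₁ ≠ s₃) (h₂₃ : s₂ ≠ s₃) :
    ∀ᶠ η in 𝓝 (0 : ℂ),
      ((∃ z : ℂ, ‖z‖ = 1 ∧ (N (I * η)).charpoly.IsRoot z) ↔
        (η * φ₁ η).im = 0 ∨ (η * φ₂ η).im = 0 ∨ (η * φ₃ η).im = 0) ∧
      (N (I * η)).charpoly.roots.countP (fun z => ‖z‖ = 1) =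
        (if (η * φ₁ η).im = 0 then 1 else 0) + (if (η * φ₂ η).im = 0 then 1 else 0) +
          (if (η * φ₃ η).im = 0 then 1 else 0) := by
  filter_upwards [eventually_roots_charpoly hN hN0 h₁ h₂ h₃ h₁₂ h₁₃ h₂₃] with η ⟨hr, n₁, n₂, n₃⟩
  constructor
  · have hmem : ∀ z, (N (I * η)).charpoly.IsRoot z ↔
        z = cayley (η * φ₁ η) ∨ z = cayley (η * φ₂ η) ∨ z = cayley (η * φ₃ η) := fun z => by
      rw [← Polynomial.mem_roots (N (I * η)).charpoly_monic.ne_zero, hr]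
      simp
    rw [← norm_cayley_eq_one_iff n₁, ← norm_cayley_eq_one_iff n₂, ← norm_cayley_eq_one_iff n₃]
    constructor
    · rintro ⟨z, hz, h⟩
      rcases (hmem z).mp h with rfl | rfl | rfl <;> simp [hz]
    · rintro (h | h | h)
      · exact ⟨_, h, (hmem _).mpr (by simp)⟩
      · exact ⟨_, h, (hmem _).mpr (by simp)⟩
      · exact ⟨_, h, (hmem _).mpr (by simp)⟩
  · rw [hr]
    simp only [Multiset.insert_eq_cons, Multiset.countP_cons, ← Multiset.cons_zero,
      Multiset.countP_zero, norm_cayley_eq_one_iff n₁, norm_cayley_eq_one_iff n₂,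
      norm_cayley_eq_one_iff n₃]
    ring

end Branch

end LocalBranches

/-! ### The spectrum near the origin in the two cases -/

section LocalSpectrum

open Filter Topology

section Local

variable {E O : ℂ → ℂ} {N : ℂ → Matrix (Fin 3) (Fin 3) ℂ}

/-- The set of parameters for which a matrix family has an eigenvalue of modulus one. -/
def unitSpectrum (N : ℂ → Matrix (Fin 3) (Fin 3) ℂ) : Set ℂ :=
  {μ | ∃ z : ℂ, ‖z‖ = 1 ∧ (N μ).charpoly.IsRoot z}

open Classical in
/-- The number of eigenvalues of modulus one, with multiplicity. -/
def unitMultiplicity (M : Matrix (Fin 3) (Fin 3) ℂ) : ℕ :=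
  M.charpoly.roots.countP fun z => ‖z‖ = 1

theorem exists_eq_I_mul {μ : ℂ} {r : ℝ} (hμ : μ ∈ ball (0 : ℂ) r) :
    ∃ η ∈ ball (0 : ℂ) r, μ = I * η ∧ (μ.re = 0 ↔ η.im = 0) := by
  refine ⟨-I * μ, by simpa using hμ, ?_, by simp⟩
  rw [← mul_assoc, mul_neg, I_mul_I, neg_neg, one_mul]

theorem simple_of_factorization {b₂ b₃ s₁ s₂ s₃ : ℂ} (h₁₂ : s₁ ≠ s₂) (h₁₃ : s₁ ≠ s₃)
    (h : ∀ x : ℂ, 4 * x ^ 3 - b₂ * x - b₃ = 4 * (x - s₁) * (x - s₂) * (x - s₃)) :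
    4 * s₁ ^ 3 - b₂ * s₁ - b₃ = 0 ∧ 12 * s₁ ^ 2 - b₂ ≠ 0 := by
  refine ⟨by rw [h]; ring, ?_⟩
  have : 12 * s₁ ^ 2 - b₂ = 4 * (s₁ - s₂) * (s₁ - s₃) := by
    -- The central difference with unit step of a cubic with leading coefficient 4 is its derivative
    -- plus 4, and this excess cancels between the sides.
    linear_combination (1 / 2) * (h (s₁ + 1) - h (s₁ - 1))
  rw [this]
  exact mul_ne_zero (mul_ne_zero (by norm_num) (sub_ne_zero.mpr h₁₂)) (sub_ne_zero.mpr h₁₃)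

theorem unitSpectrum_of_real_roots (hE : AnalyticAt ℂ E 0) (hO : AnalyticAt ℂ O 0)
    (hEc : ∀ η, E (conj η) = conj (E η)) (hOc : ∀ η, O (conj η) = conj (O η))
    (hN : ∀ η σ, 1 - I * (η * σ) ≠ 0 → (1 - I * (η * σ)) ^ 3 *
      (N (I * η)).charpoly.eval (cayley (η * σ)) = -2 * I * η ^ 3 * scaledCubic E O (η, σ))
    (hN0 : ∀ z, (N 0).charpoly.eval z = (z - 1) ^ 3) (hO0 : O 0 ≠ 0) {s₁ s₂ s₃ : ℝ}
    (h₁₂ : s₁ ≠ s₂) (h₁₃ : s₁ ≠ s₃) (h₂₃ : s₂ ≠ s₃)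
    (hfac : ∀ x : ℂ, 4 * x ^ 3 - E 0 * x - O 0 = 4 * (x - s₁) * (x - s₂) * (x - s₃)) :
    ∃ r > 0, unitSpectrum N ∩ ball 0 r = {μ : ℂ | μ.re = 0} ∩ ball 0 r ∧
      ∀ μ ∈ ball (0 : ℂ) r, μ.re = 0 → unitMultiplicity (N μ) = 3 := by
  have k₁₂ : (s₁ : ℂ) ≠ s₂ := by exact_mod_cast h₁₂
  have k₁₃ : (s₁ : ℂ) ≠ s₃ := by exact_mod_cast h₁₃
  have k₂₃ : (s₂ : ℂ) ≠ s₃ := by exact_mod_cast h₂₃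
  have hne : ∀ s : ℝ, 4 * (s : ℂ) ^ 3 - E 0 * s - O 0 = 0 → s ≠ 0 := by
    rintro s h rfl
    exact hO0 (by simpa using h)
  obtain ⟨r₁, d₁⟩ := simple_of_factorization k₁₂ k₁₃ hfac
  obtain ⟨r₂, d₂⟩ := simple_of_factorization k₁₂.symm k₂₃ fun x => (hfac x).trans (by ring)
  obtain ⟨r₃, d₃⟩ := simple_of_factorization k₁₃.symm k₂₃.symm fun x => (hfac x).trans (by ring)
  obtain ⟨φ₁, b₁⟩ := exists_isBranch hE hO r₁ d₁
  obtain ⟨φ₂, b₂⟩ := exists_isBranch hE hO r₂ d₂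
  obtain ⟨φ₃, b₃⟩ := exists_isBranch hE hO r₃ d₃
  obtain ⟨r, hr, hball⟩ := Metric.eventually_nhds_iff_ball.mp
    ((eventually_unit_roots hN hN0 b₁ b₂ b₃ k₁₂ k₁₃ k₂₃).and
      ((b₁.eventually_im_eq_zero_iff hEc hOc (hne _ r₁)).and
        ((b₂.eventually_im_eq_zero_iff hEc hOc (hne _ r₂)).and
          (b₃.eventually_im_eq_zero_iff hEc hOc (hne _ r₃)))))
  refine ⟨r, hr, ?_, fun μ hμ h0 => ?_⟩
  · ext μ
    simp only [mem_inter_iff, and_congr_left_iff, mem_ofPred_eq]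
    intro hμ
    obtain ⟨η, hη, rfl, hre⟩ := exists_eq_I_mul hμ
    obtain ⟨⟨h1, -⟩, i₁, i₂, i₃⟩ := hball η hη
    rw [hre, unitSpectrum, mem_ofPred_eq, h1, i₁, i₂, i₃]
    tauto
  · obtain ⟨η, hη, rfl, hre⟩ := exists_eq_I_mul hμ
    obtain ⟨⟨-, h1⟩, i₁, i₂, i₃⟩ := hball η hη
    have h2 := hre.mp h0
    rw [unitMultiplicity, h1, if_pos (i₁.mpr h2), if_pos (i₂.mpr h2), if_pos (i₃.mpr h2)]

/-- The real root contributes the imaginary axis. With `g` the local inverse of `η ↦ ηφ₂(η)`, the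
root `s₂` contributes `I * g τ` for real `τ`, and the conjugate root contributes the reflection of
this curve. -/
theorem unitSpectrum_of_conj_roots (hE : AnalyticAt ℂ E 0) (hO : AnalyticAt ℂ O 0)
    (hEc : ∀ η, E (conj η) = conj (E η)) (hOc : ∀ η, O (conj η) = conj (O η))
    (hN : ∀ η σ, 1 - I * (η * σ) ≠ 0 → (1 - I * (η * σ)) ^ 3 *
      (N (I * η)).charpoly.eval (cayley (η * σ)) = -2 * I * η ^ 3 * scaledCubic E O (η, σ))
    (hN0 : ∀ z, (N 0).charpoly.eval z = (z - 1) ^ 3) {s₁ : ℝ} {s₂ : ℂ}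
    (hs₁ : s₁ ≠ 0) (hre : s₂.re ≠ 0) (him : s₂.im ≠ 0)
    (hfac : ∀ x : ℂ, 4 * x ^ 3 - E 0 * x - O 0 = 4 * (x - s₁) * (x - s₂) * (x - conj s₂)) :
    ∃ r > 0, ∃ ε > 0, ∃ γ₂ γ₃ : ℝ → ℂ,
      ContDiffOn ℝ ∞ γ₂ (Ioo (-ε) ε) ∧ ContDiffOn ℝ ∞ γ₃ (Ioo (-ε) ε) ∧
      InjOn γ₂ (Ioo (-ε) ε) ∧ InjOn γ₃ (Ioo (-ε) ε) ∧
      γ₂ 0 = 0 ∧ γ₃ 0 = 0 ∧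
      HasDerivAt γ₂ (I * (-1 / (2 * s₂))) 0 ∧ HasDerivAt γ₃ (I * conj (-1 / (2 * s₂))) 0 ∧
      (∀ t ∈ Ioo (-ε) ε, t ≠ 0 → (γ₂ t).re ≠ 0 ∧ (γ₃ t).re ≠ 0) ∧
      (∀ s ∈ Ioo (-ε) ε, ∀ t ∈ Ioo (-ε) ε, γ₂ s = γ₃ t → s = 0 ∧ t = 0) ∧
      unitSpectrum N ∩ ball 0 r =
        ({μ : ℂ | μ.re = 0} ∪ γ₂ '' Ioo (-ε) ε ∪ γ₃ '' Ioo (-ε) ε) ∩ ball 0 r ∧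
      (∀ μ ∈ ball (0 : ℂ) r, μ.re = 0 → μ ≠ 0 → unitMultiplicity (N μ) = 1) ∧
      ∀ t, γ₃ t = -conj (γ₂ t) := by
  have hs₂ : s₂ ≠ 0 := fun h => hre (by rw [h, zero_re])
  have k₁₂ : (s₁ : ℂ) ≠ s₂ := fun h => him (by rw [← h, ofReal_im])
  have k₁₃ : (s₁ : ℂ) ≠ conj s₂ := fun h => him (by
    have := congrArg im h
    rw [ofReal_im, conj_im] at this
    linarith)
  have k₂₃ : s₂ ≠ conj s₂ := fun h => him (Complex.conj_eq_iff_im.mp h.symm)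
  obtain ⟨r₁, d₁⟩ := simple_of_factorization k₁₂ k₁₃ hfac
  obtain ⟨r₂, d₂⟩ := simple_of_factorization k₁₂.symm k₂₃ fun x => (hfac x).trans (by ring)
  obtain ⟨r₃, d₃⟩ := simple_of_factorization k₁₃.symm k₂₃.symm fun x => (hfac x).trans (by ring)
  obtain ⟨φ₁, b₁⟩ := exists_isBranch hE hO r₁ d₁
  obtain ⟨φ₂, b₂⟩ := exists_isBranch hE hO r₂ d₂
  obtain ⟨φ₃, b₃⟩ := exists_isBranch hE hO r₃ d₃
  obtain ⟨g, hgc, hg0, hgd, hgl, hgr⟩ := b₂.exists_inverse hs₂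
  have hφim : ∀ᶠ η in 𝓝 (0 : ℂ), (φ₂ η).im ≠ 0 :=
    ((Complex.continuous_im.tendsto _).comp b₂.tendsto).eventually_ne him
  -- The limit is `s₂²`, non-real because `s₂` is neither real nor purely imaginary. This keeps the
  -- two curves apart.
  have hcross : ∀ᶠ η in 𝓝 (0 : ℂ), (φ₂ η * conj (φ₃ η)).im ≠ 0 := by
    have h1 := (Complex.continuous_im.tendsto _).comp
      (b₂.tendsto.mul ((Complex.continuous_conj.tendsto _).comp b₃.tendsto))
    refine h1.eventually_ne ?_
    rw [Complex.conj_conj, mul_im]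
    have := mul_ne_zero hre him
    intro h
    exact this (by linarith)
  have h32 : ∀ᶠ η in 𝓝 (0 : ℂ), φ₃ (conj η) = conj (φ₂ η) :=
    IsBranch.eventually_conj hEc hOc b₂ b₃
  obtain ⟨ρ, hρ, hball⟩ := Metric.eventually_nhds_iff_ball.mp
    ((eventually_unit_roots hN hN0 b₁ b₂ b₃ k₁₂ k₁₃ k₂₃).and
      ((b₁.eventually_im_eq_zero_iff hEc hOc hs₁).and (hφim.and (hcross.and (h32.and hgl)))))
  have hgt : Tendsto g (𝓝 0) (𝓝 0) := by
    have := hgc.continuousAt.tendsto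
    rwa [hg0] at this
  obtain ⟨δ, hδ, hδball⟩ := Metric.eventually_nhds_iff_ball.mp
    (hgr.and ((hgt.eventually (ball_mem_nhds 0 hρ)).and (hgc.eventually (by simp))))
  obtain ⟨r', hr', hr'ball⟩ := Metric.eventually_nhds_iff_ball.mp
    (b₂.tendsto_mul.eventually (ball_mem_nhds 0 hδ))
  have hbc : ∀ {R : ℝ} {η : ℂ}, η ∈ ball (0 : ℂ) R → conj η ∈ ball (0 : ℂ) R := fun h => by
    simpa using h
  -- The parametrization `τ = -t/2` turns the tangent `1/s₂` into the required root `y = -1/(2s₂)`.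
  have hpar : ∀ t ∈ Ioo (-(2 * δ)) (2 * δ), ((-t / 2 : ℝ) : ℂ) ∈ ball (0 : ℂ) δ := fun t ht => by
    rw [mem_ball_zero_iff, Complex.norm_real, Real.norm_eq_abs, abs_lt]
    constructor <;> linarith [ht.1, ht.2]
  have hGρ : ∀ t ∈ Ioo (-(2 * δ)) (2 * δ), g ((-t / 2 : ℝ) : ℂ) ∈ ball (0 : ℂ) ρ := fun t ht =>
    (hδball _ (hpar t ht)).2.1
  have hGinv : ∀ t ∈ Ioo (-(2 * δ)) (2 * δ),
      g ((-t / 2 : ℝ) : ℂ) * φ₂ (g ((-t / 2 : ℝ) : ℂ)) = ((-t / 2 : ℝ) : ℂ) := fun t ht =>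
    (hδball _ (hpar t ht)).1
  have hGinj : InjOn (fun t : ℝ => g ((-t / 2 : ℝ) : ℂ)) (Ioo (-(2 * δ)) (2 * δ)) := by
    intro s hs t ht h
    have h1 := hGinv s hs
    simp only at h
    rw [h, hGinv t ht, Complex.ofReal_inj] at h1
    linarith
  have hGne : ∀ t ∈ Ioo (-(2 * δ)) (2 * δ), g ((-t / 2 : ℝ) : ℂ) = 0 → t = 0 := fun t ht h => by
    have h1 := hGinv t ht
    rw [h, zero_mul, eq_comm, Complex.ofReal_eq_zero] at h1
    linarith
  have hreal : ∀ η ∈ ball (0 : ℂ) ρ, η.im = 0 → (η * φ₂ η).im = 0 → η = 0 := fun η hη h1 h2 => by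
    rw [mul_im, h1, zero_mul, add_zero] at h2
    exact Complex.ext ((mul_eq_zero.mp h2).resolve_right (hball η hη).2.2.1) h1
  have hGim : ∀ t ∈ Ioo (-(2 * δ)) (2 * δ), t ≠ 0 → (g ((-t / 2 : ℝ) : ℂ)).im ≠ 0 :=
    fun t ht h0 h => h0 (hGne t ht (hreal _ (hGρ t ht) h (by rw [hGinv t ht, ofReal_im])))
  have hGc : ContDiffOn ℝ ∞ (fun t : ℝ => g ((-t / 2 : ℝ) : ℂ)) (Ioo (-(2 * δ)) (2 * δ)) := by
    intro t ht
    have h1 : ContDiffAt ℝ ∞ g ((-t / 2 : ℝ) : ℂ) :=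
      ((hδball _ (hpar t ht)).2.2.of_le (by simp)).restrict_scalars ℝ
    have h2 : ContDiffAt ℝ ∞ (fun t : ℝ => ((-t / 2 : ℝ) : ℂ)) t :=
      (ofRealCLM.contDiff.comp (by fun_prop : ContDiff ℝ ∞ fun t : ℝ => -t / 2)).contDiffAt
    exact (h1.comp t h2).contDiffWithinAt
  have hGd : HasDerivAt (fun t : ℝ => g ((-t / 2 : ℝ) : ℂ)) (-1 / (2 * s₂)) 0 := by
    have h1 : HasDerivAt (fun t : ℝ => ((-t / 2 : ℝ) : ℂ)) ((-1 / 2 : ℝ) : ℂ) 0 :=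
      ((hasDerivAt_id (0 : ℝ)).neg.div_const 2).ofReal_comp
    have h2 : HasDerivAt g s₂⁻¹ ((-(0 : ℝ) / 2 : ℝ) : ℂ) := by simpa using hgd
    refine (HasDerivAt.comp (h₂ := g) (h := fun t : ℝ => ((-t / 2 : ℝ) : ℂ)) (0 : ℝ)
      h2 h1).congr_deriv ?_
    push_cast
    field_simp
  -- The radius `r'` ensures that `ηφ₂(η)` lands in the `δ`-ball, so the curve over the whole
  -- parameter interval covers every real value that occurs.
  have hmem : ∀ η ∈ ball (0 : ℂ) (min ρ r'), (η * φ₂ η).im = 0 ↔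
      ∃ t ∈ Ioo (-(2 * δ)) (2 * δ), g ((-t / 2 : ℝ) : ℂ) = η := fun η hη => by
    constructor
    · intro h
      have h1 := hr'ball η (ball_subset_ball (min_le_right _ _) hη)
      have h2 : η * φ₂ η = (((η * φ₂ η).re : ℝ) : ℂ) :=
        Complex.ext (ofReal_re _).symm (by rw [h, ofReal_im])
      have h3 : (-(-2 * (η * φ₂ η).re) / 2 : ℝ) = (η * φ₂ η).re := by ring
      refine ⟨-2 * (η * φ₂ η).re, ?_, ?_⟩
      · rw [h2, dist_zero_right, Complex.norm_real, Real.norm_eq_abs, abs_lt] at h1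
        constructor <;> linarith [h1.1, h1.2]
      · rw [h3, ← h2]
        exact (hball η (ball_subset_ball (min_le_left _ _) hη)).2.2.2.2.2
    · rintro ⟨t, ht, rfl⟩
      rw [hGinv t ht, ofReal_im]
  have hh3 : ∀ η ∈ ball (0 : ℂ) ρ, η * φ₃ η = conj (conj η * φ₂ (conj η)) := fun η hη => by
    have := (hball _ (hbc hη)).2.2.2.2.1
    rw [Complex.conj_conj] at this
    rw [this, map_mul, Complex.conj_conj]
  refine ⟨min ρ r', lt_min hρ hr', 2 * δ, by linarith, fun t => I * g ((-t / 2 : ℝ) : ℂ),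
    fun t => I * conj (g ((-t / 2 : ℝ) : ℂ)), contDiffOn_const.mul hGc,
    contDiffOn_const.mul (conjCLE.contDiff.comp_contDiffOn hGc),
    fun s hs t ht h => hGinj hs ht (mul_left_cancel₀ I_ne_zero h),
    fun s hs t ht h => hGinj hs ht ((starRingEnd ℂ).injective (mul_left_cancel₀ I_ne_zero h)),
    by simp [hg0], by simp [hg0], hGd.const_mul I, hGd.star.const_mul I, fun t ht h0 => ?_,
    fun s hs t ht h => ?_, ?_, fun μ hμ hμre hμ0 => ?_, fun t => by simp⟩
  · simpa using hGim t ht h0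
  · have h1 := mul_left_cancel₀ I_ne_zero h
    have h2 := hh3 _ (hGρ s hs)
    -- At a common point both `ηφ₂(η)` and `ηφ₃(η)` are real, hence so is `|η|² φ₂ conj(φ₃)`. By
    -- `hcross` this forces `η = 0`.
    have h3 : g ((-s / 2 : ℝ) : ℂ) = 0 := by
      by_contra hne
      refine (hball _ (hGρ s hs)).2.2.2.1 ?_
      have h4 : g ((-s / 2 : ℝ) : ℂ) * φ₃ (g ((-s / 2 : ℝ) : ℂ)) = ((-t / 2 : ℝ) : ℂ) := by
        rw [h2, h1, Complex.conj_conj, hGinv t ht, Complex.conj_ofReal]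
      have h5 := hGinv s hs
      set η := g ((-s / 2 : ℝ) : ℂ)
      have h6 : ((normSq η : ℝ) : ℂ) * (φ₂ η * conj (φ₃ η)) =
          (((-s / 2) * (-t / 2) : ℝ) : ℂ) := by
        rw [Complex.ofReal_mul, ← h5, ← Complex.conj_ofReal (-t / 2), ← h4, map_mul,
          ← Complex.mul_conj]
        ring
      have h7 := congrArg im h6
      rw [im_ofReal_mul, ofReal_im] at h7
      exact (mul_eq_zero.mp h7).resolve_left (by simpa using hne)
    have h4 : g ((-t / 2 : ℝ) : ℂ) = 0 := by
      rw [h3, eq_comm] at h1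
      simpa using h1
    exact ⟨hGne s hs h3, hGne t ht h4⟩
  · ext μ
    simp only [mem_inter_iff, and_congr_left_iff, mem_union, mem_ofPred_eq]
    intro hμ
    obtain ⟨η, hη, rfl, hre'⟩ := exists_eq_I_mul hμ
    have hηρ := ball_subset_ball (min_le_left ρ r') hη
    obtain ⟨⟨h1, -⟩, i₁, -⟩ := hball η hηρ
    have h3 : (η * φ₃ η).im = 0 ↔ (conj η * φ₂ (conj η)).im = 0 := by
      rw [hh3 η hηρ, conj_im, neg_eq_zero]
    have e2 : I * η ∈ (fun t : ℝ => I * g ((-t / 2 : ℝ) : ℂ)) '' Ioo (-(2 * δ)) (2 * δ) ↔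
        ∃ t ∈ Ioo (-(2 * δ)) (2 * δ), g ((-t / 2 : ℝ) : ℂ) = η := by
      simp only [mem_image, mul_right_inj' I_ne_zero]
    have hinv : ∀ z w : ℂ, conj z = w ↔ z = conj w := fun z w =>
      ⟨by rintro rfl; simp, by rintro rfl; simp⟩
    have e3 : I * η ∈ (fun t : ℝ => I * conj (g ((-t / 2 : ℝ) : ℂ))) '' Ioo (-(2 * δ)) (2 * δ) ↔
        ∃ t ∈ Ioo (-(2 * δ)) (2 * δ), g ((-t / 2 : ℝ) : ℂ) = conj η := by
      simp only [mem_image, mul_right_inj' I_ne_zero, hinv]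
    rw [hre', e2, e3, unitSpectrum, mem_ofPred_eq, h1, i₁, h3, hmem η hη, hmem _ (hbc hη), or_assoc]
  · obtain ⟨η, hη, rfl, hre'⟩ := exists_eq_I_mul hμ
    have hηρ := ball_subset_ball (min_le_left ρ r') hη
    obtain ⟨⟨-, h1⟩, i₁, -⟩ := hball η hηρ
    have hη0 : η ≠ 0 := fun h => hμ0 (by rw [h, mul_zero])
    have h0 := hre'.mp hμre
    have h2 : (η * φ₂ η).im ≠ 0 := fun h => hη0 (hreal η hηρ h0 h)
    have h3 : (η * φ₃ η).im ≠ 0 := fun h => by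
      rw [hh3 η hηρ, conj_im, neg_eq_zero, Complex.conj_eq_iff_im.mpr h0] at h
      exact h2 h
    rw [unitMultiplicity, h1, if_pos (i₁.mpr h0), if_neg h2, if_neg h3]

end Local

end LocalSpectrum

end GKdV

end

/-! ### The main theorem -/

theorem mainTheorem1 (f : ℝ → ℝ) (hf : ContDiff ℝ 2 f) (a c : ℝ) (u : ℝ → ℝ)
    (hu : GKdV.IsStandingWave f a c u) (hnc : ¬ ∃ k : ℝ, ∀ x, u x = k)
    (T : ℝ) (hT : 0 < T) (hper : Function.Periodic u T)
    (htr : GKdV.trDeriv f c u T 3 ≠ 0) :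
    (0 < GKdV.discriminant f c u T →
      ∃ r > 0,
        GKdV.spec f c u ∩ ball 0 r = {μ : ℂ | μ.re = 0} ∩ ball 0 r ∧
        ∀ μ ∈ ball (0 : ℂ) r, μ.re = 0 → GKdV.multiplicity f c u T μ = 3) ∧
    (GKdV.discriminant f c u T < 0 →
      (∃ r > 0, ∃ ε > 0, ∃ y : ℂ, ∃ γ₂ γ₃ : ℝ → ℂ,
        y.im ≠ 0 ∧
        1 - y ^ 2 / 2 * (GKdV.trDeriv f c u T 2 : ℂ)
          + y ^ 3 / 3 * (GKdV.trDeriv f c u T 3 : ℂ) = 0 ∧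
        ContDiffOn ℝ ∞ γ₂ (Ioo (-ε) ε) ∧ ContDiffOn ℝ ∞ γ₃ (Ioo (-ε) ε) ∧
        InjOn γ₂ (Ioo (-ε) ε) ∧ InjOn γ₃ (Ioo (-ε) ε) ∧
        γ₂ 0 = 0 ∧ γ₃ 0 = 0 ∧
        HasDerivAt γ₂ (I * y) 0 ∧ HasDerivAt γ₃ (I * conj y) 0 ∧
        (∀ t ∈ Ioo (-ε) ε, t ≠ 0 → (γ₂ t).re ≠ 0 ∧ (γ₃ t).re ≠ 0) ∧
        (∀ s ∈ Ioo (-ε) ε, ∀ t ∈ Ioo (-ε) ε, γ₂ s = γ₃ t → s = 0 ∧ t = 0) ∧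
        GKdV.spec f c u ∩ ball 0 r =
          ({μ : ℂ | μ.re = 0} ∪ γ₂ '' Ioo (-ε) ε ∪ γ₃ '' Ioo (-ε) ε) ∩ ball 0 r ∧
        ∀ μ ∈ ball (0 : ℂ) r, μ.re = 0 → μ ≠ 0 → GKdV.multiplicity f c u T μ = 1) ∧
      GKdV.ModulationallyUnstable f c u) := by
  have hq := (GKdV.contDiff_one_potential hf hu.1 c).continuous
  obtain ⟨ha0, ha1⟩ := GKdV.trace_reducedMonodromy_potential hf hu hnc hper
  have htr2 := GKdV.trDeriv_eq hf hu hper 2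
  have htr3 := GKdV.trDeriv_eq hf hu hper 3
  have had : Differentiable ℂ fun μ =>
      (GKdV.reducedMonodromy (GKdV.potential f c u) T μ).trace := by
    simp only [Matrix.trace_fin_three]
    have := GKdV.differentiable_reducedMonodromy hq T
    fun_prop
  obtain ⟨E, O, hE, hO, hE0, hO0, hEc, hOc, hF⟩ := GKdV.exists_scaledCubic had
    (GKdV.trace_reducedMonodromy_conj hq T) ha0 ha1
  rw [← htr2] at hE0
  rw [← htr3] at hO0
  have hN : ∀ η σ, 1 - I * (η * σ) ≠ 0 → (1 - I * (η * σ)) ^ 3 *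
      (GKdV.reducedMonodromy (GKdV.potential f c u) T (I * η)).charpoly.eval
        (GKdV.cayley (η * σ)) = -2 * I * η ^ 3 * GKdV.scaledCubic E O (η, σ) := fun η σ h => by
    rw [GKdV.eval_charpoly_reducedMonodromy hq, hF η σ h]
  have hN0 : ∀ z, (GKdV.reducedMonodromy (GKdV.potential f c u) T 0).charpoly.eval z =
      (z - 1) ^ 3 := fun z => by
    rw [GKdV.eval_charpoly_reducedMonodromy hq, neg_zero, ha0]
    ring
  have hspec : GKdV.spec f c u =
      GKdV.unitSpectrum (GKdV.reducedMonodromy (GKdV.potential f c u) T) :=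
    Set.ext fun μ => GKdV.mem_spec_iff hf hu hT hper μ
  have hmult : ∀ μ, GKdV.multiplicity f c u T μ =
      GKdV.unitMultiplicity (GKdV.reducedMonodromy (GKdV.potential f c u) T μ) := fun μ => by
    rw [GKdV.multiplicity, GKdV.unitMultiplicity, GKdV.charpoly_monodromy hf hu hper]
  have hb3 : GKdV.trDeriv f c u T 3 / 6 ≠ 0 := div_ne_zero htr (by norm_num)
  have hdisc : GKdV.discriminant f c u T = 4 * (GKdV.trDeriv f c u T 2 / 2) ^ 3 -
      108 * (GKdV.trDeriv f c u T 3 / 6) ^ 2 := by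
    rw [GKdV.discriminant]
    ring
  simp only [hspec, hmult, GKdV.ModulationallyUnstable, hdisc]
  refine ⟨fun h => ?_, fun h => ?_⟩
  · obtain ⟨s₁, s₂, s₃, h₁₂, h₁₃, h₂₃, hfac⟩ := GKdV.exists_three_real_roots h
    rw [← hE0, ← hO0] at hfac
    exact GKdV.unitSpectrum_of_real_roots hE hO hEc hOc hN hN0
      (by rw [hO0]; exact_mod_cast hb3) h₁₂ h₁₃ h₂₃ hfac
  · obtain ⟨s₁, s₂, hs₁, hre, him, hfac⟩ := GKdV.exists_conj_roots h hb3
    have hs₂ : s₂ ≠ 0 := fun h => hre (by rw [h, zero_re])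
    have hroot := hfac s₂
    rw [sub_self, mul_zero, zero_mul] at hroot
    rw [← hE0, ← hO0] at hfac
    obtain ⟨r, hr, ε, hε, γ₂, γ₃, hc₂, hc₃, hi₂, hi₃, h0₂, h0₃, hd₂, hd₃, hoff, hcross, hset, hm,
      hsymm⟩ := GKdV.unitSpectrum_of_conj_roots hE hO hEc hOc hN hN0 hs₁ hre him hfac
    refine ⟨⟨r, hr, ε, hε, -1 / (2 * s₂), γ₂, γ₃, fun h => him ?_, ?_, hc₂, hc₃, hi₂, hi₃, h0₂,
      h0₃, hd₂, hd₃, hoff, hcross, hset, hm⟩, fun r' hr' => ?_⟩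
    · have h1 : s₂ = -1 / (2 * (-1 / (2 * s₂))) := by field_simp
      have h2 : (conj (-1 / (2 * s₂)) : ℂ) = -1 / (2 * s₂) := Complex.conj_eq_iff_im.mpr h
      rw [← Complex.conj_eq_iff_im, h1]
      simp only [map_div₀, map_mul, map_neg, map_one, map_ofNat] at h2 ⊢
      rw [h2]
    · push_cast at hroot
      field_simp
      -- Substituting `y = -1/(2s₂)` turns the cubic in `y` into the scaled cubic at `s₂` divided by
      -- `4s₂³`.
      linear_combination 6 * hroot
    · have hcont : ∀ᶠ t in nhds (0 : ℝ), ‖γ₂ t‖ < min r r' := by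
        have := hd₂.continuousAt.norm.tendsto
        rw [h0₂, norm_zero] at this
        exact this.eventually_lt_const (lt_min hr hr')
      obtain ⟨t, ⟨ht, htε⟩, ht0⟩ := (((hcont.and (Ioo_mem_nhds (neg_lt_zero.mpr hε) hε)).filter_mono
        nhdsWithin_le_nhds).and (self_mem_nhdsWithin (s := {(0 : ℝ)}ᶜ))).exists
      have hin : ∀ μ : ℂ, ‖μ‖ < r → (μ = γ₂ t ∨ μ = γ₃ t) →
          μ ∈ GKdV.unitSpectrum (GKdV.reducedMonodromy (GKdV.potential f c u) T) := by
        intro μ hμ h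
        have : μ ∈ ({μ : ℂ | μ.re = 0} ∪ γ₂ '' Ioo (-ε) ε ∪ γ₃ '' Ioo (-ε) ε) ∩ ball 0 r := by
          refine ⟨?_, by simpa using hμ⟩
          rcases h with rfl | rfl
          · exact Or.inl (Or.inr ⟨t, htε, rfl⟩)
          · exact Or.inr ⟨t, htε, rfl⟩
        rw [← hset] at this
        exact this.1
      have hn : ‖γ₃ t‖ = ‖γ₂ t‖ := by rw [hsymm, norm_neg, RCLike.norm_conj]
      -- The curves are mirror images in the imaginary axis and avoid it for `t ≠ 0`, so exactly one
      -- of `γ₂ t` and `γ₃ t` has positive real part.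
      rcases lt_or_gt_of_ne (hoff t htε ht0).1 with hneg | hpos
      · refine ⟨γ₃ t, hin _ (by rw [hn]; exact ht.trans_le (min_le_left _ _)) (Or.inr rfl),
          by rw [hn]; exact ht.trans_le (min_le_right _ _), ?_⟩
        rw [hsymm]
        simpa using hneg
      · exact ⟨γ₂ t, hin _ (ht.trans_le (min_le_left _ _)) (Or.inl rfl),
          ht.trans_le (min_le_right _ _), hpos⟩
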